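/- Let $\eta>0$ and consider the Airy equation with large parameter $\left(-\frac{d^2}{dx^2}+\eta^2x\right)\psi=0$. Let $S=\sum_{j\ge -1}\eta^{-j}S_j(x)$ be the formal solution of the Riccati equation $\frac{dS}{dx}+S^2=\eta^2x$ with $S_{-1}=x^{1/2}$ (principal branch), that is, $S_{j+1}=-\frac{1}{2S_{-1}}\Big(\frac{dS_j}{dx}+\sum_{k=0}^{j}S_kS_{j-k}\Big)$ for $j\ge -1$; put $S_{\rm odd}=\sum_{j\ge -1}\eta^{-2j-1}S_{2j+1}$, and let $$\psi_\pm=\frac{1}{\sqrt{S_{\rm odd}}}\exp\Big(\pm\int_0^xS_{\rm odd}\,dx\Big) =e^{\pm\frac23x^{3/2}\eta}\sum_{n\ge 0}\psi_{\pm,n}(x)\,\eta^{-n-\frac12}$$ be the associated WKB solutions. Here $\int_0^xS_{\rm odd}\,dx$ is one half of the termwise integral of $S_{\rm odd}$ along the path that starts at $x$ on the second sheet of the Riemann surface of $\sqrt x$, goes around the origin counterclockwise and ends at $x$ on the first sheet, and $\frac{1}{\sqrt{S_{\rm odd}}}=\eta^{-1/2}x^{-1/4}(1+O(\eta^{-2}))$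 as a formal series, with the principal branch of $x^{-1/4}$. Let $$\psi_{\pm,B}(x,y)=\sum_{n\ge 0}\frac{\psi_{\pm,n}(x)}{\Gamma(n+\frac12)}\Big(y\pm\tfrac23x^{3/2}\Big)^{n-\frac12}$$ be their Borel transforms, continued analytically from a neighbourhood of $y=\mp\frac23x^{3/2}$ along the half-line $\ell_\pm(x)=\{\mp\frac23x^{3/2}+t\mid t\ge 0\}$, on which $\big(y\pm\frac23x^{3/2}\big)^{1/2}\ge 0$. For $x$ in the Stokes region ${\mathcal R}_{\rm I}=\{x\in{\mathbb C}\mid -\frac{2\pi}{3}<\arg x<0\}$ let $$\Psi_\pm^{\rm I}(x,\eta)=\int_{\ell_\pm(x)}\psi_{\pm,B}(x,y)\,e^{-y\eta}\,dy$$ be the Borel sums of $\psi_\pm$. Finally let $${\rm Ai}(z)=\frac{1}{2\pi i}\int_{\gamma_1}e^{-z\xi+\xi^3/3}\,d\xi,\qquad {\rm Bi}(z)=\frac{1}{2\pi}\int_{-\gamma_2+\gamma_3}e^{-z\xi+\xi^3/3}\,d\xi,$$ where $\gamma_1$ runs from $\infty e^{-i\pi/3}$ to $\infty e^{i\pi/3}$,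 $\gamma_2$ from $\infty e^{i\pi/3}$ to $\infty e^{i\pi}$, and $\gamma_3$ from $\infty e^{i\pi}$ to $\infty e^{-i\pi/3}$. Theorem. For every $x\in{\mathcal R}_{\rm I}$ and every $\eta>0$ the Borel transforms $\psi_{\pm,B}(x,\cdot)$ exist along $\ell_\pm(x)$, the integrals $\Psi_\pm^{\rm I}(x,\eta)$ converge absolutely, and $$\begin{aligned} {\rm Ai}(\eta^{2/3}x)&=\eta^{1/3}\frac{1}{2\sqrt\pi}\,\Psi_-^{\rm I}(x,\eta),\\ {\rm Bi}(\eta^{2/3}x)&=\eta^{1/3}\frac{1}{\sqrt\pi}\,\Psi_+^{\rm I}(x,\eta)-\eta^{1/3}\frac{i}{2\sqrt\pi}\,\Psi_-^{\rm I}(x,\eta). \end{aligned}$$ -/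

import Mathlib

open scoped Real

noncomputable section

namespace AiryWKB

/-! ### The Airy functions -/

/-- The integral of `exp (-z ξ + ξ³ / 3)` along the half-line from `0` to infinity in the
direction `exp (i θ)`.  It converges absolutely for `θ = π/3, -π/3, π`, where `ξ³ < 0`. -/
def airyRay (θ : ℝ) (z : ℂ) : ℂ :=
  ∫ r in Set.Ioi (0 : ℝ),
    Complex.exp (-z * (r * Complex.exp (θ * Complex.I))
      + (r * Complex.exp (θ * Complex.I)) ^ 3 / 3) * Complex.exp (θ * Complex.I)

/-- The integral along `γ₁`, which runs from `∞ exp (-iπ/3)` to `∞ exp (iπ/3)`. -/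
def airyContour₁ (z : ℂ) : ℂ := airyRay (π / 3) z - airyRay (-(π / 3)) z

/-- The integral along `γ₂`, which runs from `∞ exp (iπ/3)` to `∞ exp (iπ)`. -/
def airyContour₂ (z : ℂ) : ℂ := airyRay π z - airyRay (π / 3) z

/-- The integral along `γ₃`, which runs from `∞ exp (iπ)` to `∞ exp (-iπ/3)`. -/
def airyContour₃ (z : ℂ) : ℂ := airyRay (-(π / 3)) z - airyRay π z

/-- The Airy function `Ai`. -/
def Ai (z : ℂ) : ℂ := 1 / (2 * π * Complex.I) * airyContour₁ z

/-- The Airy function `Bi`, the integral along `-γ₂ + γ₃`. -/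
def Bi (z : ℂ) : ℂ := 1 / (2 * π) * (-airyContour₂ z + airyContour₃ z)

/-! ### The formal WKB solutions of `(-d²/dx² + η² x) ψ = 0` -/

/-- `riccati n` is `S_{n-1}`, where `S = ∑_{j ≥ -1} η^{-j} S_j` is the formal solution of the
Riccati equation `dS/dx + S² = η² x` with `S_{-1} = x^{1/2}`, as a function of the coordinate
`u = x^{1/2}` of the Riemann surface of the square root, so that `d/dx = (2u)⁻¹ d/du`:
`S_{j+1} = -(2 S_{-1})⁻¹ (dS_j/dx + ∑_{k=0}^{j} S_k S_{j-k})`. -/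
def riccati : ℕ → ℂ → ℂ
  | 0 => fun u => u
  | n + 1 => fun u =>
      -(1 / (2 * u)) * (deriv (riccati n) u / (2 * u)
        + ∑ k : Fin n, riccati (k + 1) u * riccati (n - k) u)
  termination_by n => n
  decreasing_by all_goals omega

/-- `∫₀ˣ S_{n-1} dx`, for `n` even: one half of the integral of `S_{n-1}` along the path that
starts at `x` on the second sheet (`u = -x^{1/2}`), goes around the origin counterclockwise, and
ends at `x` on the first sheet (`u = x^{1/2}`).
With `u = x^{1/2} exp (i θ)`, `-π ≤ θ ≤ 0`, one has `d(u²) = 2 i u² dθ`. -/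
def riccatiPrimitive (n : ℕ) (x : ℂ) : ℂ :=
  1 / 2 * ∫ θ in (-π)..0,
    riccati n (x ^ (1 / 2 : ℂ) * Complex.exp (θ * Complex.I)) *
      (2 * Complex.I * (x ^ (1 / 2 : ℂ) * Complex.exp (θ * Complex.I)) ^ 2)

/-- The power series `A` in `w = η⁻¹` without constant term such that
`S_odd = ∑_{j ≥ -1} η^{-2j-1} S_{2j+1} = η x^{1/2} (1 + A)`. -/
def oddCorrection (x : ℂ) : PowerSeries ℂ :=
  PowerSeries.mk fun m =>
    if Even m ∧ m ≠ 0 then riccati m (x ^ (1 / 2 : ℂ)) / riccati 0 (x ^ (1 / 2 : ℂ)) else 0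

/-- The power series `B` in `w = η⁻¹` such that `∫₀ˣ S_odd dx = η ∫₀ˣ S_{-1} dx + B`. -/
def oddPrimitive (x : ℂ) : PowerSeries ℂ :=
  PowerSeries.mk fun m => if Odd m then riccatiPrimitive (m + 1) x else 0

/-- The data of a formal series `exp (exponent * η) * ∑_n coeff n * η ^ (-n - 1/2)`. -/
structure FormalSeries where
  exponent : ℂ
  coeff : ℕ → ℂ

/-- The WKB solution `S_odd ^ (-1/2) * exp (ε ∫₀ˣ S_odd dx)` at the point `x`; the solutions `ψ₊`
and `ψ₋` are those for `ε = 1` and `ε = -1`.  Here `S_odd ^ (-1/2)` is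
`η ^ (-1/2) * x ^ (-1/4) * (1 + A) ^ (-1/2)`. -/
def wkb (ε : ℂ) (x : ℂ) : FormalSeries where
  exponent := ε * riccatiPrimitive 0 x
  coeff n := x ^ (-1 / 4 : ℂ) * PowerSeries.coeff n
    ((PowerSeries.binomialSeries ℂ (-1 / 2 : ℂ)).subst (oddCorrection x) *
      (PowerSeries.exp ℂ).subst (PowerSeries.C ε * oddPrimitive x))

/-! ### Borel transform and Borel sum -/

/-- The half-line `{p + t | t ≥ 0}` in the `y`-plane. -/
def halfLine (p : ℂ) : Set ℂ := {y | ∃ t : ℝ, 0 ≤ t ∧ y = p + t}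

/-- `f` is the Borel transform of the formal series `ψ`, continued analytically along the half-line
that starts at `y = -ψ.exponent`.  With `a` for the exponent, the Borel transform is
`∑_n c_n (y + a) ^ (n - 1/2) / Γ (n + 1/2)`, that is `(y + a) ^ (-1/2)`, positive for
`y + a > 0`, times a power series; this power series converges near `y = -a` to a function `G`
that is analytic along the half-line. -/
def IsBorelTransform (ψ : FormalSeries) (f : ℂ → ℂ) : Prop :=
  ∃ G : ℂ → ℂ,
    AnalyticOnNhd ℂ G (halfLine (-ψ.exponent)) ∧
    (∀ᶠ y in nhds (-ψ.exponent),
      HasSum (fun n : ℕ => ψ.coeff n / Complex.Gamma (n + 1 / 2) * (y + ψ.exponent) ^ n) (G y)) ∧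
    ∀ y ∈ halfLine (-ψ.exponent), f y = (y + ψ.exponent) ^ (-1 / 2 : ℂ) * G y

/-- The integrand `f (y) exp (-y η)` of the Laplace integral at `y = p + t`. -/
def laplaceIntegrand (f : ℂ → ℂ) (p : ℂ) (η t : ℝ) : ℂ :=
  f (p + t) * Complex.exp (-(p + t) * η)

/-- `ψ` is Borel summable at `η`: its Borel transform exists along the half-line that starts at
`-ψ.exponent`, and its Laplace integral there converges absolutely. -/
def BorelSummable (ψ : FormalSeries) (η : ℝ) : Prop :=
  ∃ f, IsBorelTransform ψ f ∧
    MeasureTheory.IntegrableOn (laplaceIntegrand f (-ψ.exponent) η) (Set.Ioi 0)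

open Classical in
/-- The Borel sum of `ψ` at `η` (meaningful if `ψ` is Borel summable at `η`): the integral of
`f (y) exp (-y η)` over the half-line from `-ψ.exponent`, where `f` is the Borel transform. -/
def borelSum (ψ : FormalSeries) (η : ℝ) : ℂ :=
  if h : ∃ f, IsBorelTransform ψ f then
    ∫ t in Set.Ioi (0 : ℝ), laplaceIntegrand h.choose (-ψ.exponent) η t
  else 0

/-- The Borel transform is unique along the half-line. -/
theorem IsBorelTransform.eqOn {ψ : FormalSeries} {f g : ℂ → ℂ} (hf : IsBorelTransform ψ f)
    (hg : IsBorelTransform ψ g) : Set.EqOn f g (halfLine (-ψ.exponent)) := by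
  obtain ⟨F, hF, hF', hfF⟩ := hf
  obtain ⟨G, hG, hG', hgG⟩ := hg
  have hconn : IsPreconnected (halfLine (-ψ.exponent)) := by
    have : halfLine (-ψ.exponent)
        = (fun t : ℝ => -ψ.exponent + (t : ℂ)) '' Set.Ici (0 : ℝ) := by
      ext y
      constructor
      · rintro ⟨t, ht, rfl⟩
        exact ⟨t, ht, rfl⟩
      · rintro ⟨t, ht, rfl⟩
        exact ⟨t, ht, rfl⟩
    rw [this]
    exact isPreconnected_Ici.image _ (by fun_prop)
  have h0 : -ψ.exponent ∈ halfLine (-ψ.exponent) := ⟨0, le_rfl, by simp⟩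
  have hFG : Set.EqOn F G (halfLine (-ψ.exponent)) :=
    hF.eqOn_of_preconnected_of_eventuallyEq hG hconn h0
      (by filter_upwards [hF', hG'] with y h1 h2 using h1.unique h2)
  intro y hy
  rw [hfF y hy, hgG y hy, hFG hy]

/-- The Borel sum is the Laplace integral of the Borel transform. -/
theorem borelSum_eq {ψ : FormalSeries} {f : ℂ → ℂ} (hf : IsBorelTransform ψ f) (η : ℝ) :
    borelSum ψ η = ∫ t in Set.Ioi (0 : ℝ), laplaceIntegrand f (-ψ.exponent) η t := by
  have h : ∃ f, IsBorelTransform ψ f := ⟨f, hf⟩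
  rw [borelSum, dif_pos h]
  refine MeasureTheory.setIntegral_congr_fun measurableSet_Ioi fun t ht => ?_
  have hmem : -ψ.exponent + (t : ℂ) ∈ halfLine (-ψ.exponent) := ⟨t, le_of_lt ht, rfl⟩
  have := h.choose_spec.eqOn hf hmem
  simp only [laplaceIntegrand, this]

/-- The Stokes region `R_I`. -/
def stokesRegionI : Set ℂ := {x | -(2 * π / 3) < x.arg ∧ x.arg < 0}

/-- The Borel sum `Ψ₊` of the WKB solution `ψ₊`. -/
def PsiPlus (x : ℂ) (η : ℝ) : ℂ := borelSum (wkb 1 x) η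

/-- The Borel sum `Ψ₋` of the WKB solution `ψ₋`. -/
def PsiMinus (x : ℂ) (η : ℝ) : ℂ := borelSum (wkb (-1) x) η

/-- The leading exponent: `∫₀ˣ x^{1/2} dx = (2/3) x^{3/2}`. -/
theorem riccatiPrimitive_zero (x : ℂ) :
    riccatiPrimitive 0 x = 2 / 3 * x ^ (3 / 2 : ℂ) := by
  have h3 : x ^ (3 / 2 : ℂ) = (x ^ (1 / 2 : ℂ)) ^ 3 := by
    rw [← Complex.cpow_nat_mul]
    norm_num
  have key : ∫ θ in (-π)..0, Complex.exp ((3 * Complex.I) * (θ : ℂ))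
      = (Complex.exp (3 * Complex.I * ((0 : ℝ) : ℂ))
        - Complex.exp (3 * Complex.I * ((-π : ℝ) : ℂ))) / (3 * Complex.I) :=
    integral_exp_mul_complex (by simp)
  have hE : Complex.exp (3 * Complex.I * ((-π : ℝ) : ℂ)) = -1 := by
    have : 3 * Complex.I * ((-π : ℝ) : ℂ) = ((-3 : ℤ) : ℂ) * (π * Complex.I) := by
      push_cast
      ring
    rw [this, Complex.exp_int_mul, Complex.exp_pi_mul_I]
    norm_num
  have hI : ∀ θ : ℝ, riccati 0 (x ^ (1 / 2 : ℂ) * Complex.exp (θ * Complex.I)) *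
      (2 * Complex.I * (x ^ (1 / 2 : ℂ) * Complex.exp (θ * Complex.I)) ^ 2)
      = (2 * Complex.I * (x ^ (1 / 2 : ℂ)) ^ 3) * Complex.exp ((3 * Complex.I) * (θ : ℂ)) := by
    intro θ
    have h : Complex.exp ((3 * Complex.I) * (θ : ℂ)) = Complex.exp (θ * Complex.I) ^ 3 := by
      rw [← Complex.exp_nat_mul]
      congr 1
      push_cast
      ring
    rw [h, riccati]
    ring
  have hI0 : Complex.I ≠ 0 := Complex.I_ne_zero
  rw [riccatiPrimitive, h3]
  simp only [hI, intervalIntegral.integral_const_mul, key, hE]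
  simp only [Complex.ofReal_zero, mul_zero, Complex.exp_zero]
  field_simp
  ring

end AiryWKB

end

open scoped Real

noncomputable section

namespace AiryWKB

section

/-! ### Homogeneity of the formal solution of the Riccati equation -/

/-! In the coordinate `u = x^{1/2}` the Riccati recursion is homogeneous: each coefficient is a
number times a power of `u`, and derivatives in `x` become derivatives in `w = η⁻¹`. The Riccati
equations on the two sheets then give a linear second order equation in `w` for `(1 + A)^(-1/2) exp
(ε B)` (`wkbSeries_equation`), hence a two-term recurrence (`coeff_succ_wkbSeries`). Division by `Γ
(n + 1/2)` turns it into the recurrence of `₂F₁(1/6, 5/6; 1/2; -σ²)`, whose sum is `cosh ((2/3)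
arsinh σ) / cosh (arsinh σ)` (`hasSum_borelKernel`). This puts the Borel transform in closed form,
with `σ² = 3 t / (4 v⁶)` at distance `t` from the start of the half-line.

The same function comes from the Airy integral. With `ξ = 2 v² cosh ((2/3) arsinh σ ± iπ/3)` the
triple angle formula gives `-v⁴ ξ + ξ³/3 = -(2/3 v⁶ + t)`, so these are the two halves of the
steepest descent path through the saddle `v²`, and their velocities differ by `i/v` times the kernel
over `√t`. The Laplace integral is therefore the integral along `γ₁` at `z = v⁴`, up to the factor
`v/i` (`integral_saddleIntegrand`).

One computation serves both signs: only `v⁶ = -ε x^{3/2}` matters. For `ε = -1` take `v = x^{1/4}`;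
for `ε = 1` take `v = x^{1/4} e^{iπ/6}`, where `z = e^{2πi/3} x` and a rotation carries `γ₁` to
`γ₂`. In the Stokes region both choices are admissible, so the half-lines avoid the singularity `σ²
= -1`. Finally `γ₁ + γ₂ + γ₃ = 0` yields `Bi`. -/

/-- The coefficient `s_n` in `S_{n-1} = s_n u ^ (1 - 3 n)`. -/
def riccatiCoeff (n : ℕ) : ℂ := riccati n 1

theorem riccati_succ (n : ℕ) (u : ℂ) : riccati (n + 1) u =
    -(1 / (2 * u)) * (deriv (riccati n) u / (2 * u)
        + ∑ k : Fin n, riccati (k + 1) u * riccati (n - k) u) := by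
  rw [riccati]

theorem riccatiCoeff_zero : riccatiCoeff 0 = 1 := by
  rw [riccatiCoeff, riccati]

theorem deriv_of_homogeneous {f : ℂ → ℂ} {a : ℂ} {m : ℤ} (hf : ∀ u, u ≠ 0 → f u = a * u ^ m)
    {u : ℂ} (hu : u ≠ 0) : deriv f u = a * (m * u ^ (m - 1)) := by
  have h : f =ᶠ[nhds u] fun u => a * u ^ m := by
    filter_upwards [isOpen_ne.mem_nhds hu] with w hw using hf w hw
  rw [h.deriv_eq, deriv_const_mul _ (differentiableAt_zpow.2 (Or.inl hu)), deriv_zpow]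

/-- Both terms of the recursion have the same degree `-1 - 3n` in `u`: the operator `(2u)⁻¹ d/du`
lowers the degree by 2, and the degrees `1 - 3(k+1)` and `1 - 3(n-k)` add up to it. -/
theorem riccati_eq (n : ℕ) : ∀ u : ℂ, u ≠ 0 →
    riccati n u = riccatiCoeff n * u ^ (1 - 3 * (n : ℤ)) := by
  induction n using Nat.strong_induction_on with
  | _ n ih =>
    intro u hu
    cases n with
    | zero => simp [riccatiCoeff, riccati]
    | succ n =>
      rw [riccatiCoeff, riccati_succ, riccati_succ]
      rw [deriv_of_homogeneous (ih n (by omega)) hu,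
        deriv_of_homogeneous (ih n (by omega)) one_ne_zero]
      have hs : ∑ k : Fin n, riccati (k + 1) u * riccati (n - k) u =
          (∑ k : Fin n, riccati (k + 1) 1 * riccati (n - k) 1) * u ^ (-1 - 3 * (n : ℤ)) := by
        rw [Finset.sum_mul]
        refine Finset.sum_congr rfl fun k _ => ?_
        rw [ih (k + 1) (by omega) u hu, ih (n - k) (by omega) u hu, mul_mul_mul_comm,
          ← zpow_add₀ hu, riccatiCoeff, riccatiCoeff]
        congr 2
        have := k.2
        push_cast [Nat.cast_sub this.le]
        ring
      rw [hs]
      have e1 : u ^ (1 - 3 * (n : ℤ) - 1) = u ^ (-1 - 3 * (n : ℤ)) * u := by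
        rw [← zpow_add_one₀ hu]
        congr 1
        ring
      have e2 : u ^ (-1 - 3 * (n : ℤ)) = u ^ (1 - 3 * ((n + 1 : ℕ) : ℤ)) * u := by
        rw [← zpow_add_one₀ hu]
        congr 1
        push_cast
        ring
      rw [e1, e2]
      simp only [one_zpow]
      field_simp

theorem riccatiCoeff_succ (n : ℕ) : riccatiCoeff (n + 1) =
    -(1 / 2) * (riccatiCoeff n * (1 - 3 * n) / 2
      + ∑ k : Fin n, riccatiCoeff (k + 1) * riccatiCoeff (n - k)) := by
  rw [riccatiCoeff, riccati_succ, deriv_of_homogeneous (riccati_eq n) one_ne_zero]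
  simp [riccatiCoeff]

theorem intervalIntegral_exp_odd {m : ℕ} (hm : Odd m) :
    ∫ θ in (-π)..0, Complex.exp ((-(3 * m) * Complex.I) * (θ : ℂ)) =
      2 / (-(3 * m) * Complex.I) := by
  have hm0 : (m : ℂ) ≠ 0 := by
    have := hm.pos
    exact_mod_cast this.ne'
  rw [integral_exp_mul_complex (by simp [hm0])]
  have : -(3 * (m : ℂ)) * Complex.I * ((-π : ℝ) : ℂ) = ((3 * m : ℕ) : ℂ) * (π * Complex.I) := by
    push_cast
    ring
  rw [this, Complex.exp_nat_mul, Complex.exp_pi_mul_I, Odd.neg_one_pow (by simp [Nat.odd_mul, hm]; decide)]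
  simp
  norm_num

/-- For odd `m` the half turn changes the sign of `u^(-3m)`, so the two ends of the path contribute
equally and half the integral is the usual power primitive at `x`. -/
theorem riccatiPrimitive_succ_of_odd {m : ℕ} (hm : Odd m) {x : ℂ} (hx : x ≠ 0) :
    riccatiPrimitive (m + 1) x =
      -(2 / (3 * m)) * (riccatiCoeff (m + 1) * ((x ^ (1 / 2 : ℂ)) ^ (-3 : ℤ)) ^ m) := by
  have hm0 : (m : ℂ) ≠ 0 := by
    have := hm.pos
    exact_mod_cast this.ne'
  set u := x ^ (1 / 2 : ℂ) with hu
  have hu0 : u ≠ 0 := by simp [hu, Complex.cpow_eq_zero_iff, hx]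
  have hI : ∀ θ : ℝ, riccati (m + 1) (u * Complex.exp (θ * Complex.I)) *
      (2 * Complex.I * (u * Complex.exp (θ * Complex.I)) ^ 2)
      = (2 * Complex.I * (riccatiCoeff (m + 1) * (u ^ (-3 : ℤ)) ^ m)) *
        Complex.exp ((-(3 * m) * Complex.I) * (θ : ℂ)) := by
    intro θ
    have hE : Complex.exp ((-(3 * m) * Complex.I) * (θ : ℂ))
        = (Complex.exp (θ * Complex.I) ^ (-3 : ℤ)) ^ m := by
      rw [← Complex.exp_int_mul, ← Complex.exp_nat_mul]
      congr 1
      push_cast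
      ring
    have hne : u * Complex.exp (θ * Complex.I) ≠ 0 := mul_ne_zero hu0 (Complex.exp_ne_zero _)
    have : (u * Complex.exp (θ * Complex.I)) ^ (1 - 3 * ((m + 1 : ℕ) : ℤ)) *
        (u * Complex.exp (θ * Complex.I)) ^ 2 = ((u * Complex.exp (θ * Complex.I)) ^ (-3 : ℤ)) ^ m := by
      rw [← zpow_natCast, ← zpow_natCast, ← zpow_mul, ← zpow_add₀ hne]
      congr 1
      push_cast
      ring
    have h' : (u ^ (-3 : ℤ)) ^ m * (Complex.exp (θ * Complex.I) ^ (-3 : ℤ)) ^ m =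
        ((u * Complex.exp (θ * Complex.I)) ^ (-3 : ℤ)) ^ m := by
      rw [← mul_pow, ← mul_zpow]
    rw [riccati_eq _ _ hne, hE]
    linear_combination (2 * Complex.I * riccatiCoeff (m + 1)) * (this - h')
  rw [riccatiPrimitive]
  simp only [← hu, hI, intervalIntegral.integral_const_mul, intervalIntegral_exp_odd hm]
  have hI0 : Complex.I ≠ 0 := Complex.I_ne_zero
  field_simp

/-! ### The formal power series identities -/

open PowerSeries

/-- The power series `∑ s_n (c w) ^ n`; for `c = u ^ (-3)` it is `S / (η u)`. -/
def riccatiSeries (c : ℂ) : PowerSeries ℂ := PowerSeries.mk fun n => riccatiCoeff n * c ^ n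

/-- This is the Riccati equation divided by `(η u)²`. By homogeneity `dS/dx = (η / 2u) (U - 3 w U')`
for `S = η u U`, so only derivatives in `w` remain. -/
theorem riccatiSeries_equation (c : ℂ) :
    riccatiSeries c * riccatiSeries c + C (c / 2) * X * riccatiSeries c
      - C (3 / 2 * c) * X ^ 2 * d⁄dX ℂ (riccatiSeries c) = 1 := by
  ext n
  have h1 : ∀ r : ℂ, ∀ f : PowerSeries ℂ, C r * X * f = X * (C r * f) := fun r f => by ring
  have h2 : ∀ r : ℂ, ∀ f : PowerSeries ℂ, C r * X ^ 2 * f = X * (X * (C r * f)) :=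
    fun r f => by ring
  rw [h1, h2]
  cases n with
  | zero => simp [riccatiSeries, riccatiCoeff_zero]
  | succ n =>
    rw [map_sub, map_add, coeff_succ_X_mul, coeff_succ_X_mul, coeff_one, if_neg n.succ_ne_zero,
      coeff_mul, Finset.Nat.sum_antidiagonal_eq_sum_range_succ_mk, Finset.sum_range_succ,
      Finset.sum_range_succ', ← Fin.sum_univ_eq_sum_range
        (fun k => coeff (k + 1) (riccatiSeries c) * coeff (n + 1 - (k + 1)) (riccatiSeries c))]
    have hs : ∑ k : Fin n, coeff ((k : ℕ) + 1) (riccatiSeries c) *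
        coeff (n + 1 - (k + 1)) (riccatiSeries c) =
        (∑ k : Fin n, riccatiCoeff (k + 1) * riccatiCoeff (n - k)) * c ^ (n + 1) := by
      rw [Finset.sum_mul]
      refine Finset.sum_congr rfl fun k _ => ?_
      have : n + 1 = (k + 1) + (n - k) := by omega
      rw [Nat.add_sub_add_right, this, pow_add]
      simp only [riccatiSeries, coeff_mk]
      ring
    rw [hs]
    have hX : coeff n (X * (C (3 / 2 * c) * d⁄dX ℂ (riccatiSeries c))) =
        3 / 2 * c * (n * (riccatiCoeff n * c ^ n)) := by
      cases n with
      | zero => simp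
      | succ n =>
        rw [coeff_succ_X_mul, coeff_C_mul, coeff_derivative]
        simp only [riccatiSeries, coeff_mk]
        push_cast
        ring
    rw [hX, coeff_C_mul]
    simp only [riccatiSeries, coeff_mk, Nat.sub_self, Nat.sub_zero, riccatiCoeff_zero]
    rw [riccatiCoeff_succ n]
    ring

theorem binomialSeries_neg_half_sq :
    PowerSeries.binomialSeries ℂ (-1 / 2 : ℂ) ^ 2 * (1 + X) = 1 := by
  have h : (1 + X : PowerSeries ℂ) = PowerSeries.binomialSeries ℂ (1 : ℂ) := by
    have := binomialSeries_nat (R := ℂ) (A := ℂ) 1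
    simpa using this.symm
  rw [h, sq, ← binomialSeries_add, ← binomialSeries_add]
  norm_num

theorem constantCoeff_subst_of_constantCoeff_zero {A : PowerSeries ℂ} (hA : constantCoeff A = 0)
    (f : PowerSeries ℂ) : constantCoeff (f.subst A) = constantCoeff f := by
  have h := HasSubst.of_constantCoeff_zero' hA
  have hf : f = (f - C (constantCoeff f)) + C (constantCoeff f) := by ring
  conv_lhs => rw [hf]
  have h1 : constantCoeff ((f - C (constantCoeff f)).subst A) = 0 :=
    constantCoeff_subst_eq_zero hA _ (by simp)
  have h2 : (C (constantCoeff f)).subst A = (C (constantCoeff f) : PowerSeries ℂ) := subst_C _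
  rw [subst_add h, map_add, h1, h2]
  simp

/-- The formal series `(1 + A) ^ (-1/2) * exp (ε B)`. -/
def wkbSeries (ε x : ℂ) : PowerSeries ℂ :=
  (PowerSeries.binomialSeries ℂ (-1 / 2 : ℂ)).subst (oddCorrection x) *
      (PowerSeries.exp ℂ).subst (C ε * oddPrimitive x)

theorem constantCoeff_oddCorrection (x : ℂ) : constantCoeff (oddCorrection x) = 0 := by
  simp [oddCorrection, ← coeff_zero_eq_constantCoeff_apply]

theorem constantCoeff_oddPrimitive (ε x : ℂ) : constantCoeff (C ε * oddPrimitive x) = 0 := by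
  simp [oddPrimitive, ← coeff_zero_eq_constantCoeff_apply]

theorem constantCoeff_wkbSeries (ε x : ℂ) : constantCoeff (wkbSeries ε x) = 1 := by
  rw [wkbSeries, map_mul, constantCoeff_subst_of_constantCoeff_zero (constantCoeff_oddCorrection x),
    constantCoeff_subst_of_constantCoeff_zero (constantCoeff_oddPrimitive ε x)]
  simp

/-- Replacing `c` by `-c` is passing to the other sheet `u ↦ -u`; the average keeps the even powers
of `w`, which are the `S_j` with odd `j`. -/
theorem one_add_oddCorrection {x : ℂ} (hx : x ≠ 0) :
    1 + oddCorrection x = C (1 / 2 : ℂ) * (riccatiSeries ((x ^ (1 / 2 : ℂ)) ^ (-3 : ℤ)) +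
      riccatiSeries (-(x ^ (1 / 2 : ℂ)) ^ (-3 : ℤ))) := by
  set u := x ^ (1 / 2 : ℂ) with hu
  have hu0 : u ≠ 0 := by simp [hu, Complex.cpow_eq_zero_iff, hx]
  ext n
  simp only [oddCorrection, riccatiSeries, map_add, coeff_one, coeff_mk, coeff_C_mul, ← hu]
  rcases Nat.eq_zero_or_pos n with rfl | hn
  · simp [riccatiCoeff_zero]
    norm_num
  rcases Nat.even_or_odd n with h | h
  · rw [if_neg hn.ne', if_pos ⟨h, hn.ne'⟩, h.neg_pow, riccati_eq _ _ hu0, riccati_eq _ _ hu0,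
      riccatiCoeff_zero]
    have : u ^ (1 - 3 * (n : ℤ)) = (u ^ (-3 : ℤ)) ^ n * u := by
      rw [← zpow_natCast, ← zpow_mul, ← zpow_add_one₀ hu0]
      congr 1
      ring
    rw [this]
    simp
    field_simp
    ring
  · rw [if_neg hn.ne', if_neg (by simp [h]), h.neg_pow]
    ring

theorem derivative_oddPrimitive {x : ℂ} (hx : x ≠ 0) :
    C (-(3 / 2) * (x ^ (1 / 2 : ℂ)) ^ (-3 : ℤ)) * X ^ 2 * d⁄dX ℂ (oddPrimitive x) =
      oddCorrection x := by
  set u := x ^ (1 / 2 : ℂ) with hu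
  have hu0 : u ≠ 0 := by simp [hu, Complex.cpow_eq_zero_iff, hx]
  have h2 : ∀ r : ℂ, ∀ f : PowerSeries ℂ, C r * X ^ 2 * f = X * (X * (C r * f)) :=
    fun r f => by ring
  rw [h2]
  ext n
  match n with
  | 0 => simp [oddCorrection]
  | 1 => simp [oddCorrection, coeff_zero_X_mul, coeff_succ_X_mul 0]
  | n + 2 =>
    rw [coeff_succ_X_mul, coeff_succ_X_mul, coeff_C_mul, coeff_derivative]
    simp only [oddCorrection, oddPrimitive, coeff_mk, ← hu]
    rcases Nat.even_or_odd n with h | h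
    · have h' : Odd (n + 1) := h.add_one
      rw [if_pos h', if_pos ⟨h.add (by decide), by omega⟩, riccatiPrimitive_succ_of_odd h' hx, ← hu,
        riccati_eq _ _ hu0, riccati_eq _ _ hu0, riccatiCoeff_zero]
      have : u ^ (1 - 3 * ((n + 2 : ℕ) : ℤ)) = u ^ (-3 : ℤ) * (u ^ (-3 : ℤ)) ^ (n + 1) * u := by
        rw [← pow_succ', ← zpow_natCast, ← zpow_mul, ← zpow_add_one₀ hu0]
        congr 1
      rw [this]
      have hn : (n : ℂ) + 1 ≠ 0 := by exact_mod_cast n.succ_ne_zero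
      push_cast
      field_simp
    · have h' : ¬ Odd (n + 1) := by simpa using h.add_one
      have h'' : ¬ Even (n + 2) := by simpa using h.add_even (by decide : Even 2)
      rw [if_neg h', if_neg (fun h => h'' h.1)]
      simp

theorem hasSubst_oddCorrection (x : ℂ) : HasSubst (oddCorrection x) :=
  HasSubst.of_constantCoeff_zero' (constantCoeff_oddCorrection x)

/-- The second order differential equation for the formal series `(1 + A) ^ (-1/2) * exp (ε B)`. -/
theorem wkbSeries_equation {ε x : ℂ} (hε : ε ^ 2 = 1) (hx : x ≠ 0) :
    C (36 * (x ^ (1 / 2 : ℂ)) ^ (-3 : ℤ)) *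
        (X * (X * d⁄dX ℂ (d⁄dX ℂ (wkbSeries ε x))) + 2 * (X * d⁄dX ℂ (wkbSeries ε x)))
      - C (48 * ε) * d⁄dX ℂ (wkbSeries ε x)
      + C (5 * (x ^ (1 / 2 : ℂ)) ^ (-3 : ℤ)) * wkbSeries ε x = 0 := by
  have hT := one_add_oddCorrection hx
  have hB := derivative_oddPrimitive hx
  set c := (x ^ (1 / 2 : ℂ)) ^ (-3 : ℤ) with hc
  have hc0 : c ≠ 0 := zpow_ne_zero _ (by simp [Complex.cpow_eq_zero_iff, hx])
  have hU := riccatiSeries_equation c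
  have hW := riccatiSeries_equation (-c)
  set U := riccatiSeries c
  set W := riccatiSeries (-c)
  set A := oddCorrection x
  set B := oddPrimitive x
  set P := (PowerSeries.binomialSeries ℂ (-1 / 2 : ℂ)).subst A with hP
  set E := (PowerSeries.exp ℂ).subst (C ε * B) with hE
  have hΦ : wkbSeries ε x = P * E := rfl
  rw [hΦ]
  have half : (2 : PowerSeries ℂ) * C (1 / 2 : ℂ) = 1 := by
    rw [← map_ofNat C, ← map_mul]
    norm_num
  have hthree : (2 : PowerSeries ℂ) * C (3 / 2 : ℂ) = 3 := by
    rw [← map_ofNat C, ← map_mul, ← map_ofNat C]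
    norm_num
  have e2 : (2 : PowerSeries ℂ) * C (c / 2) = C c := by
    rw [← map_ofNat C, ← map_mul]
    congr 1
    ring
  have e3 : (2 : PowerSeries ℂ) * C (3 / 2 * c) = 3 * C c := by
    rw [map_mul]
    linear_combination C c * hthree
  have e2' : C (-c / 2) = - C (c / 2) := by rw [← map_neg]; congr 1; ring
  have e3' : C (3 / 2 * -c) = - C (3 / 2 * c) := by rw [← map_neg]; congr 1; ring
  have e3'' : C (-(3 / 2) * c) = - C (3 / 2 * c) := by rw [← map_neg]; congr 1; ring
  rw [e2', e3'] at hW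
  rw [e3''] at hB
  have hε' : (C ε : PowerSeries ℂ) ^ 2 = 1 := by rw [← map_pow, hε, map_one]
  have h2 : (2 : PowerSeries ℂ) ≠ 0 := by
    rw [← map_ofNat C]
    simp
  have hTd : 2 * d⁄dX ℂ A = d⁄dX ℂ U + d⁄dX ℂ W := by
    have := congrArg (d⁄dX ℂ) hT
    simp only [map_add, Derivation.leibniz, derivative_one, derivative_C, smul_eq_mul] at this
    linear_combination 2 * this + (d⁄dX ℂ U + d⁄dX ℂ W) * half
  have hT' : 2 * (1 + A) = U + W := by linear_combination 2 * hT + (U + W) * half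
  set M := U - W with hM
  have hMd : d⁄dX ℂ M = d⁄dX ℂ U - d⁄dX ℂ W := map_sub _ _ _
  set k : PowerSeries ℂ := C c * X with hk
  set T := 1 + A with hTdef
  have hTA : d⁄dX ℂ T = d⁄dX ℂ A := by rw [hTdef, map_add, derivative_one, zero_add]
  -- The sum of the Riccati equations on the two sheets. Here `T` is `S_odd / (η u)` and `M` is
  -- twice the even part of `S` over `η u`.
  have E1 : 4 * T ^ 2 + M ^ 2 + k * M - 3 * k * X * d⁄dX ℂ M = 4 := by
    have h4 : 4 * T ^ 2 = (U + W) ^ 2 := by rw [← hT']; ring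
    rw [h4, hMd, hM, hk]
    linear_combination 2 * hU + 2 * hW - X * (U - W) * e2
      + X ^ 2 * (d⁄dX ℂ U - d⁄dX ℂ W) * e3
  -- The difference of the two equations: it expresses the even part through the logarithmic
  -- derivative of `S_odd`.
  have E2 : 2 * T * M + k * T = 3 * k * X * d⁄dX ℂ T := by
    apply mul_left_cancel₀ h2
    rw [hTA, hk]
    linear_combination (2 * (U - W) + C c * X) * hT' - 3 * C c * X ^ 2 * hTd + 2 * hU - 2 * hW
      - X * (U + W) * e2 + X ^ 2 * (d⁄dX ℂ U + d⁄dX ℂ W) * e3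
  have hPT : P ^ 2 * T = 1 := by
    have := congrArg (PowerSeries.subst A) binomialSeries_neg_half_sq
    have h1 : PowerSeries.subst A (1 : PowerSeries ℂ) = (1 : PowerSeries ℂ) := by
      rw [← coe_substAlgHom (hasSubst_oddCorrection x), map_one]
    rwa [subst_mul (hasSubst_oddCorrection x), subst_pow (hasSubst_oddCorrection x),
      subst_add (hasSubst_oddCorrection x), subst_X (hasSubst_oddCorrection x), h1] at this
  have hP0 : P ≠ 0 := by
    rintro h
    rw [h] at hPT
    simp at hPT
  have hT0 : T ≠ 0 := by
    rintro h
    rw [h] at hPT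
    simp at hPT
  have hPd : 2 * d⁄dX ℂ P * T = - (P * d⁄dX ℂ T) := by
    have := congrArg (d⁄dX ℂ) hPT
    simp only [Derivation.leibniz, derivative_one, smul_eq_mul, sq] at this
    apply mul_left_cancel₀ hP0
    linear_combination this
  have E3 : 6 * k * X * d⁄dX ℂ P = - (P * (2 * M + k)) := by
    apply mul_left_cancel₀ hT0
    linear_combination 3 * k * X * hPd + P * E2
  have hEd : d⁄dX ℂ E = C ε * d⁄dX ℂ B * E := by
    rw [hE, derivative_subst (HasSubst.of_constantCoeff_zero' (constantCoeff_oddPrimitive ε x)),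
      derivative_exp, Derivation.leibniz]
    simp only [derivative_C, smul_eq_mul]
    ring
  have E4 : -(3 * k * X * d⁄dX ℂ B) = 2 * (T - 1) := by
    rw [hk, hTdef]
    linear_combination 2 * hB + X ^ 2 * d⁄dX ℂ B * e3
  set Φ := P * E with hΦdef
  set R := 2 * M + k + 4 * C ε * (T - 1) with hR
  -- `R` is, up to a factor, the logarithmic derivative of `Φ`. Differentiating this relation once
  -- more produces the second order equation.
  have E5 : 6 * k * X * d⁄dX ℂ Φ = - (R * Φ) := by
    rw [hΦdef, Derivation.leibniz, smul_eq_mul, smul_eq_mul, hEd, hR]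
    linear_combination E * E3 - 2 * C ε * P * E * E4
  have hRd : d⁄dX ℂ R = 2 * d⁄dX ℂ M + C c + 4 * C ε * d⁄dX ℂ T := by
    have h4 : (d⁄dX ℂ) (4 : PowerSeries ℂ) = 0 := by
      rw [← map_ofNat C]
      exact derivative_C
    have h2 : (d⁄dX ℂ) (2 : PowerSeries ℂ) = 0 := by
      rw [← map_ofNat C]
      exact derivative_C
    simp only [hR, hk, map_add, map_sub, Derivation.leibniz, derivative_one, derivative_C,
      derivative_X, smul_eq_mul, h2, h4]
    ring
  have E6 : 12 * k * d⁄dX ℂ Φ + 6 * k * X * d⁄dX ℂ (d⁄dX ℂ Φ) =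
      - (d⁄dX ℂ R * Φ) - R * d⁄dX ℂ Φ := by
    have := congrArg (d⁄dX ℂ) E5
    have h6 : (d⁄dX ℂ) (6 : PowerSeries ℂ) = 0 := by
      rw [← map_ofNat C]
      exact derivative_C
    simp only [map_neg, Derivation.leibniz, derivative_C, derivative_X, smul_eq_mul, h6, hk] at this
    rw [hk]
    linear_combination this
  have hkX : C c * X ^ 2 ≠ (0 : PowerSeries ℂ) := by
    refine mul_ne_zero ?_ (pow_ne_zero _ X_ne_zero)
    simpa using hc0
  have n36 : C (36 * c) = 36 * C c := by rw [map_mul, map_ofNat]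
  have n48 : C (48 * ε) = 48 * C ε := by rw [map_mul, map_ofNat]
  have n5 : C (5 * c) = 5 * C c := by rw [map_mul, map_ofNat]
  rw [n36, n48, n5]
  apply mul_left_cancel₀ hkX
  rw [hRd] at E6
  -- In the derivative of `R`, `E1` eliminates `M'` and `E2` eliminates `T'`; with `ε² = 1` the
  -- quadratic terms cancel, leaving only a multiple of `R` and a multiple of `k²`.
  have key : 6 * k * X * (12 * k * d⁄dX ℂ Φ + 6 * k * X * d⁄dX ℂ (d⁄dX ℂ Φ)) =
      - (8 * C ε * R + 5 * k ^ 2) * Φ := by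
    rw [E6]
    have hkX' : X * C c = k := by rw [hk]; ring
    rw [hR]
    rw [hR] at E5
    linear_combination (-(2 * M + k + 4 * C ε * (T - 1))) * E5 + 4 * Φ * E1 + 8 * C ε * Φ * E2
      - 6 * k * Φ * hkX' + (16 * (T - 1) ^ 2 + 32 * (T - 1)) * Φ * hε'
  rw [hk] at key
  rw [hk] at E5
  linear_combination key + (-8 * C ε) * E5

theorem coeff_succ_wkbSeries {ε x : ℂ} (hε : ε ^ 2 = 1) (hx : x ≠ 0) (n : ℕ) :
    coeff (n + 1) (wkbSeries ε x) = ε * (3 / 4) * (x ^ (1 / 2 : ℂ)) ^ (-3 : ℤ) *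
      ((n + 1 / 6) * (n + 5 / 6) / (n + 1)) * coeff n (wkbSeries ε x) := by
  have h := congrArg (coeff n) (wkbSeries_equation hε hx)
  have h1 : ∀ f : PowerSeries ℂ, coeff n (X * d⁄dX ℂ f) = n * coeff n f := by
    intro f
    cases n with
    | zero => simp
    | succ n =>
      rw [coeff_succ_X_mul, coeff_derivative]
      push_cast
      ring
  have h2 : coeff n (X * (X * d⁄dX ℂ (d⁄dX ℂ (wkbSeries ε x)))) =
      n * (n - 1) * coeff n (wkbSeries ε x) := by
    have : X * (X * d⁄dX ℂ (d⁄dX ℂ (wkbSeries ε x))) =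
        X * d⁄dX ℂ (X * d⁄dX ℂ (wkbSeries ε x)) - X * d⁄dX ℂ (wkbSeries ε x) := by
      rw [Derivation.leibniz, derivative_X]
      simp only [smul_eq_mul]
      ring
    rw [this, map_sub, h1, h1]
    ring
  have h3 : (2 : PowerSeries ℂ) = C 2 := (map_ofNat C 2).symm
  rw [map_add, map_sub, coeff_C_mul, coeff_C_mul, coeff_C_mul, map_add, h2, h3, coeff_C_mul, h1,
    coeff_derivative, map_zero] at h
  have hn : (n : ℂ) + 1 ≠ 0 := by exact_mod_cast n.succ_ne_zero
  generalize (x ^ (1 / 2 : ℂ)) ^ (-3 : ℤ) = c at h ⊢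
  field_simp
  -- The numerator comes from `36 n (n-1) + 72 n + 5 = 36 (n + 1/6) (n + 5/6)`.
  linear_combination (-3 * ε) * h - 144 * (n + 1) * coeff (n + 1) (wkbSeries ε x) * hε

end

section

/-! ### The function `cosh ((2/3) arsinh σ) / cosh (arsinh σ)` -/

/-- `cosh (arsinh σ) = (1 + σ²)^{1/2}`. -/
def coshArsinh (σ : ℂ) : ℂ := (1 + σ ^ 2) ^ (1 / 2 : ℂ)

/-- The complex inverse hyperbolic sine. -/
def arsinhC (σ : ℂ) : ℂ := Complex.log (σ + coshArsinh σ)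

/-- `cosh ((2/3) arsinh σ) / cosh (arsinh σ)`. -/
def borelKernel (σ : ℂ) : ℂ := Complex.cosh (2 / 3 * arsinhC σ) / coshArsinh σ

theorem coshArsinh_sq (σ : ℂ) : coshArsinh σ ^ 2 = 1 + σ ^ 2 := by
  rw [coshArsinh, ← Complex.cpow_nat_mul]
  norm_num

theorem add_coshArsinh_ne_zero (σ : ℂ) : σ + coshArsinh σ ≠ 0 := by
  intro h
  have h2 := coshArsinh_sq σ
  have : coshArsinh σ = -σ := by linear_combination h
  rw [this] at h2
  simp at h2

theorem exp_arsinhC (σ : ℂ) : Complex.exp (arsinhC σ) = σ + coshArsinh σ :=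
  Complex.exp_log (add_coshArsinh_ne_zero σ)

theorem exp_neg_arsinhC (σ : ℂ) : Complex.exp (-arsinhC σ) = coshArsinh σ - σ := by
  rw [Complex.exp_neg, exp_arsinhC]
  refine inv_eq_of_mul_eq_one_right ?_
  linear_combination coshArsinh_sq σ

theorem cosh_arsinhC (σ : ℂ) : Complex.cosh (arsinhC σ) = coshArsinh σ := by
  rw [Complex.cosh, exp_arsinhC, exp_neg_arsinhC]
  ring

theorem sinh_arsinhC (σ : ℂ) : Complex.sinh (arsinhC σ) = σ := by
  rw [Complex.sinh, exp_arsinhC, exp_neg_arsinhC]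
  ring

theorem arsinhC_zero : arsinhC 0 = 0 := by simp [arsinhC, coshArsinh]

/-- The plane without the half-lines from `±i` to `±i ∞`. -/
def slitDomain : Set ℂ := {σ | 1 + σ ^ 2 ∈ Complex.slitPlane}

theorem isOpen_slitDomain : IsOpen slitDomain :=
  Complex.isOpen_slitPlane.preimage (by fun_prop)

theorem coshArsinh_ne_zero {σ : ℂ} (h : σ ∈ slitDomain) : coshArsinh σ ≠ 0 := by
  intro h0
  have h2 := coshArsinh_sq σ
  rw [h0] at h2
  exact Complex.slitPlane_ne_zero h (by linear_combination -h2)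

theorem coshArsinh_re_pos {σ : ℂ} (h : σ ∈ slitDomain) : 0 < (coshArsinh σ).re := by
  have h0 := Complex.slitPlane_ne_zero h
  rw [coshArsinh, Complex.cpow_def_of_ne_zero h0, Complex.exp_re]
  refine mul_pos (Real.exp_pos _) (Real.cos_pos_of_mem_Ioo ?_)
  have h1 : (Complex.log (1 + σ ^ 2) * (1 / 2)).im = (1 + σ ^ 2).arg / 2 := by
    have : Complex.log (1 + σ ^ 2) * (1 / 2) = ((1 / 2 : ℝ) : ℂ) * Complex.log (1 + σ ^ 2) := by
      push_cast
      ring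
    rw [this, Complex.im_ofReal_mul, Complex.log_im]
    ring
  rw [h1]
  have := Complex.neg_pi_lt_arg (1 + σ ^ 2)
  have := (Complex.arg_le_pi (1 + σ ^ 2)).lt_of_ne (Complex.mem_slitPlane_iff_arg.1 h).1
  constructor <;> linarith

/-- `σ + w` and `w - σ` are inverse to each other, so their real parts have the same sign, and these
add up to `2 Re w > 0`. Thus the logarithm in `arsinhC` stays off its cut. -/
theorem add_coshArsinh_re_pos {σ : ℂ} (h : σ ∈ slitDomain) : 0 < (σ + coshArsinh σ).re := by
  set w := coshArsinh σ
  have hw : 0 < w.re := coshArsinh_re_pos h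
  have hsum : (σ + w) * (w - σ) = 1 := by linear_combination coshArsinh_sq σ
  have h1 : (w - σ) = (σ + w)⁻¹ := (inv_eq_of_mul_eq_one_right hsum).symm
  have h2 : (w - σ).re = (σ + w).re / Complex.normSq (σ + w) := by rw [h1, Complex.inv_re]
  have h3 : (w - σ).re + (σ + w).re = 2 * w.re := by simp; ring
  by_contra hle
  push Not at hle
  have : (σ + w).re / Complex.normSq (σ + w) ≤ 0 :=
    div_nonpos_of_nonpos_of_nonneg hle (Complex.normSq_nonneg _)
  linarith

theorem hasDerivAt_coshArsinh {σ : ℂ} (h : σ ∈ slitDomain) :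
    HasDerivAt coshArsinh (σ / coshArsinh σ) σ := by
  have h1 : HasDerivAt (fun σ : ℂ => 1 + σ ^ 2) (2 * σ) σ := by
    simpa using (hasDerivAt_pow 2 σ).const_add 1
  have h2 : HasDerivAt coshArsinh (1 / 2 * (1 + σ ^ 2) ^ (1 / 2 - 1 : ℂ) * (2 * σ)) σ :=
    h1.cpow_const h
  refine h2.congr_deriv ?_
  rw [Complex.cpow_sub _ _ (Complex.slitPlane_ne_zero h), Complex.cpow_one,
    show (1 + σ ^ 2) ^ (1 / 2 : ℂ) = coshArsinh σ from rfl, ← coshArsinh_sq]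
  have h3 := coshArsinh_ne_zero h
  field_simp

theorem hasDerivAt_arsinhC {σ : ℂ} (h : σ ∈ slitDomain) :
    HasDerivAt arsinhC (1 / coshArsinh σ) σ := by
  have h1 := ((hasDerivAt_id σ).add (hasDerivAt_coshArsinh h)).clog
    (Or.inl (add_coshArsinh_re_pos h))
  refine h1.congr_deriv ?_
  have h3 := coshArsinh_ne_zero h
  have h4 := add_coshArsinh_ne_zero σ
  simp only [Pi.add_apply, id]
  field_simp
  ring

theorem hasDerivAt_borelKernel {σ : ℂ} (h : σ ∈ slitDomain) :
    HasDerivAt borelKernel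
      ((2 / 3 * Complex.sinh (2 / 3 * arsinhC σ) - σ * borelKernel σ) / (1 + σ ^ 2)) σ := by
  have h3 := coshArsinh_ne_zero h
  have h1 := (((hasDerivAt_arsinhC h).const_mul (2 / 3)).ccosh).div (hasDerivAt_coshArsinh h) h3
  refine h1.congr_deriv ?_
  rw [borelKernel, ← coshArsinh_sq]
  field_simp

theorem differentiableOn_borelKernel : DifferentiableOn ℂ borelKernel slitDomain :=
  fun _ h => (hasDerivAt_borelKernel h).differentiableAt.differentiableWithinAt

theorem analyticAt_borelKernel {σ : ℂ} (h : σ ∈ slitDomain) : AnalyticAt ℂ borelKernel σ :=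
  differentiableOn_borelKernel.analyticAt (isOpen_slitDomain.mem_nhds h)

theorem ball_subset_slitDomain : Metric.ball (0 : ℂ) 1 ⊆ slitDomain := by
  intro σ hσ
  rw [mem_ball_zero_iff] at hσ
  refine Or.inl ?_
  have h1 : |(σ ^ 2).re| ≤ ‖σ ^ 2‖ := Complex.abs_re_le_norm _
  rw [norm_pow] at h1
  have h2 := neg_abs_le (σ ^ 2).re
  have : ‖σ‖ ^ 2 < 1 := by nlinarith [norm_nonneg σ]
  rw [Complex.add_re, Complex.one_re]
  linarith

/-! ### Differential equation and Taylor coefficients of the kernel -/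

theorem hasDerivAt_iteratedDeriv_borelKernel (n : ℕ) {σ : ℂ} (h : σ ∈ slitDomain) :
    HasDerivAt (iteratedDeriv n borelKernel) (iteratedDeriv (n + 1) borelKernel σ) σ := by
  have := (analyticAt_borelKernel h).iterated_deriv n
  rw [← iteratedDeriv_eq_iterate] at this
  rw [iteratedDeriv_succ]
  exact this.differentiableAt.hasDerivAt

/-- The kernel `f` satisfies `(1 + σ²) f' + σ f = (2/3) sinh ((2/3) arsinh σ)`. One derivative
closes this to a second order equation, and each further derivative raises `n` by one. -/
theorem iteratedDeriv_borelKernel_equation (n : ℕ) : ∀ σ ∈ slitDomain,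
    (1 + σ ^ 2) * iteratedDeriv (n + 2) borelKernel σ
      + (2 * n + 3) * σ * iteratedDeriv (n + 1) borelKernel σ
      + ((n + 1) ^ 2 - 4 / 9) * iteratedDeriv n borelKernel σ = 0 := by
  have hd : ∀ σ : ℂ, HasDerivAt (fun σ : ℂ => 1 + σ ^ 2) (2 * σ) σ := fun σ => by
    simpa using (hasDerivAt_pow 2 σ).const_add 1
  induction n with
  | zero =>
    intro σ hσ
    have h1 : (fun σ => (1 + σ ^ 2) * iteratedDeriv 1 borelKernel σ + σ * borelKernel σ)
        =ᶠ[nhds σ] fun σ => 2 / 3 * Complex.sinh (2 / 3 * arsinhC σ) := by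
      filter_upwards [isOpen_slitDomain.mem_nhds hσ] with τ hτ
      rw [iteratedDeriv_one, (hasDerivAt_borelKernel hτ).deriv]
      have := Complex.slitPlane_ne_zero hτ
      field_simp
      ring
    have hL := ((hd σ).mul (hasDerivAt_iteratedDeriv_borelKernel 1 hσ)).add
      ((hasDerivAt_id σ).mul (hasDerivAt_borelKernel hσ).differentiableAt.hasDerivAt)
    have hR := ((((hasDerivAt_arsinhC hσ).const_mul (2 / 3)).csinh).const_mul (2 / 3)).congr_of_eventuallyEq h1
    have := hL.unique hR
    rw [← iteratedDeriv_one] at this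
    have h3 : Complex.cosh (2 / 3 * arsinhC σ) * (2 / 3 * (1 / coshArsinh σ)) =
        2 / 3 * borelKernel σ := by
      rw [borelKernel]
      ring
    rw [h3] at this
    simp only [id] at this
    simp only [zero_add, Nat.cast_zero, iteratedDeriv_zero]
    linear_combination this
  | succ n ih =>
    intro σ hσ
    have h1 := ((((hd σ).mul (hasDerivAt_iteratedDeriv_borelKernel (n + 2) hσ)).add
      (((hasDerivAt_id σ).const_mul (2 * n + 3 : ℂ)).mul
        (hasDerivAt_iteratedDeriv_borelKernel (n + 1) hσ))).add
      ((hasDerivAt_iteratedDeriv_borelKernel n hσ).const_mul ((n + 1) ^ 2 - 4 / 9 : ℂ)))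
    have h2 := h1.unique ((hasDerivAt_const σ (0 : ℂ)).congr_of_eventuallyEq (by
      filter_upwards [isOpen_slitDomain.mem_nhds hσ] with τ hτ using ih τ hτ))
    simp only [id] at h2
    push_cast
    linear_combination h2

theorem iteratedDeriv_borelKernel_zero_add_two (n : ℕ) :
    iteratedDeriv (n + 2) borelKernel 0 =
      -((n + 1) ^ 2 - 4 / 9) * iteratedDeriv n borelKernel 0 := by
  have := iteratedDeriv_borelKernel_equation n 0 (ball_subset_slitDomain (by simp))
  linear_combination this

theorem borelKernel_zero : borelKernel 0 = 1 := by
  simp [borelKernel, arsinhC_zero, coshArsinh]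

theorem iteratedDeriv_borelKernel_zero_of_odd (n : ℕ) :
    iteratedDeriv (2 * n + 1) borelKernel 0 = 0 := by
  induction n with
  | zero =>
    rw [mul_zero, zero_add, iteratedDeriv_one,
      (hasDerivAt_borelKernel (ball_subset_slitDomain (by simp))).deriv]
    simp [arsinhC_zero]
  | succ n ih =>
    rw [show 2 * (n + 1) + 1 = (2 * n + 1) + 2 by ring, iteratedDeriv_borelKernel_zero_add_two, ih,
      mul_zero]

/-- The Taylor expansion at the origin, in terms of the recurrence of its coefficients. -/
theorem hasSum_borelKernel {b : ℕ → ℂ} (h0 : b 0 = 1)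
    (hb : ∀ n : ℕ, b (n + 1) = -((n + 1 / 6) * (n + 5 / 6) / ((n + 1) * (n + 1 / 2))) * b n)
    {σ : ℂ} (hσ : ‖σ‖ < 1) : HasSum (fun n => b n * (σ ^ 2) ^ n) (borelKernel σ) := by
  have h := Complex.hasSum_taylorSeries_on_ball
    (differentiableOn_borelKernel.mono ball_subset_slitDomain) (mem_ball_zero_iff.2 hσ)
  have hinj : Function.Injective fun n : ℕ => 2 * n := fun a b h => by simpa using h
  rw [← hinj.hasSum_iff] at h
  · refine (congrArg (fun f => HasSum f (borelKernel σ)) (funext fun n => ?_)).mpr h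
    simp only [Function.comp, sub_zero, smul_eq_mul]
    -- The recurrences agree because `(2n+1)² - 4/9 = 4 (n + 1/6) (n + 5/6)` and `(2n+1)(2n+2) = 4
    -- (n + 1/2) (n + 1)`.
    have : b n = ((2 * n).factorial : ℂ)⁻¹ * iteratedDeriv (2 * n) borelKernel 0 := by
      induction n with
      | zero => simp [h0, borelKernel_zero]
      | succ n ih =>
        rw [hb, ih, show 2 * (n + 1) = 2 * n + 2 by ring, iteratedDeriv_borelKernel_zero_add_two,
          Nat.factorial_succ, Nat.factorial_succ]
        have h1 : (n : ℂ) + 1 ≠ 0 := by exact_mod_cast n.succ_ne_zero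
        have h2 : (n : ℂ) * 2 + 1 ≠ 0 := by exact_mod_cast (n * 2).succ_ne_zero
        have h3 : ((2 * n).factorial : ℂ) ≠ 0 := by exact_mod_cast (2 * n).factorial_ne_zero
        have h4 : 2 * (n : ℂ) + 1 + 1 = 2 * (n + 1) := by ring
        have h5 : (n : ℂ) + 1 / 2 = (n * 2 + 1) / 2 := by ring
        push_cast
        rw [h4, h5]
        field_simp
        ring
    rw [this, pow_mul]
    ring
  · intro m hm
    have : Odd m := by
      rw [← Nat.not_even_iff_odd]
      rintro ⟨k, hk⟩
      exact hm ⟨k, by simp only; omega⟩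
    obtain ⟨k, rfl⟩ := this
    simp [iteratedDeriv_borelKernel_zero_of_odd]

end

section

open Filter Topology MeasureTheory

/-! ### Endpoints at infinity of contours for the Airy integrand -/

/-- With an entire primitive, contour integrals become differences of limits at the ends, and no
contour has to be deformed. -/
theorem exists_airy_primitive (z : ℂ) :
    ∃ P : ℂ → ℂ, ∀ ξ, HasDerivAt P (Complex.exp (-z * ξ + ξ ^ 3 / 3)) ξ := by
  have hd : Differentiable ℂ fun ξ : ℂ => Complex.exp (-z * ξ + ξ ^ 3 / 3) := by fun_prop
  obtain ⟨P, hP⟩ := hd.isExactOn_univ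
  exact ⟨P, fun ξ => hP ξ (Set.mem_univ ξ)⟩

/-- A relative error `1/20` moves `e³ = -1` by less than `1/2`, so the cubic term has real part at
most `-R³/6`. The bound on `R²` makes this outweigh the linear term `2 ‖z‖ R` with `2R` to spare. -/
theorem norm_airy_integrand_le {z e δ : ℂ} {R : ℝ} (he : e ^ 3 = -1) (he' : ‖e‖ = 1)
    (hδ : ‖δ‖ ≤ 1 / 20) (hR : 12 * ‖z‖ + 12 ≤ R ^ 2) (hR0 : 0 ≤ R) :
    ‖Complex.exp (-z * (R * (e + δ)) + (R * (e + δ)) ^ 3 / 3)‖ ≤ Real.exp (-(2 * R)) := by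
  rw [Complex.norm_exp, Real.exp_le_exp, Complex.add_re]
  have h1 : (-z * (R * (e + δ))).re ≤ ‖z‖ * (R * 2) := by
    refine (Complex.re_le_norm _).trans ?_
    rw [norm_mul, norm_neg, norm_mul, Complex.norm_real, Real.norm_of_nonneg hR0]
    have : ‖e + δ‖ ≤ 2 := (norm_add_le _ _).trans (by linarith)
    gcongr
  have h2 : ((R * (e + δ)) ^ 3 / 3).re ≤ -(R ^ 3 / 6) := by
    have h3 : ‖3 * e ^ 2 * δ + 3 * e * δ ^ 2 + δ ^ 3‖ ≤ 1 / 2 := by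
      refine (norm_add₃_le).trans ?_
      simp only [norm_mul, norm_pow, he', Complex.norm_ofNat]
      have := norm_nonneg δ
      nlinarith [mul_nonneg this this, pow_le_pow_left₀ this hδ 3, pow_le_pow_left₀ this hδ 2]
    have h4 := (Complex.re_le_norm _).trans h3
    have h5 : (R * (e + δ)) ^ 3 / 3 =
        ((R ^ 3 / 3 : ℝ) : ℂ) * (-1 + (3 * e ^ 2 * δ + 3 * e * δ ^ 2 + δ ^ 3)) := by
      push_cast
      linear_combination (R : ℂ) ^ 3 / 3 * he
    rw [h5, Complex.re_ofReal_mul, Complex.add_re (-1)]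
    simp only [Complex.neg_re, Complex.one_re]
    have : 0 ≤ R ^ 3 / 3 := by positivity
    nlinarith
  nlinarith [norm_nonneg z]

theorem eventually_le_sq (K : ℝ) : ∀ᶠ R : ℝ in atTop, K ≤ R ^ 2 :=
  (tendsto_pow_atTop two_ne_zero).eventually_ge_atTop K

theorem tendsto_primitive_ray {z e : ℂ} (he : e ^ 3 = -1) (he' : ‖e‖ = 1) {P : ℂ → ℂ}
    (hP : ∀ ξ, HasDerivAt P (Complex.exp (-z * ξ + ξ ^ 3 / 3)) ξ) :
    Tendsto (fun R : ℝ => P (R * e)) atTop (𝓝 (P 0 + ∫ r in Set.Ioi (0 : ℝ),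
      Complex.exp (-z * (r * e) + (r * e) ^ 3 / 3) * e)) := by
  have hc : Continuous fun r : ℝ => Complex.exp (-z * (r * e) + (r * e) ^ 3 / 3) * e := by
    fun_prop
  have hint : IntegrableOn (fun r : ℝ => Complex.exp (-z * (r * e) + (r * e) ^ 3 / 3) * e)
      (Set.Ioi 0) := by
    rw [IntegrableOn, ← integrable_norm_iff hc.aestronglyMeasurable]
    refine integrable_of_isBigO_exp_neg (b := 2) (by norm_num) hc.norm.continuousOn ?_
    refine Asymptotics.IsBigO.of_bound 1 ?_
    filter_upwards [eventually_le_sq (12 * ‖z‖ + 12), eventually_ge_atTop 0] with R hR hR0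
    have := norm_airy_integrand_le (δ := 0) he he' (by norm_num) hR hR0
    rw [add_zero] at this
    rwa [norm_norm, norm_mul, he', mul_one, one_mul, Real.norm_of_nonneg (Real.exp_pos _).le,
      neg_mul 2]
  have h := (intervalIntegral_tendsto_integral_Ioi 0 hint tendsto_id).const_add (P 0)
  refine h.congr fun R => ?_
  have hd : ∀ r : ℝ, HasDerivAt (fun r : ℝ => P (r * e))
      (Complex.exp (-z * (r * e) + (r * e) ^ 3 / 3) * e) r := by
    intro r
    have h1 : HasDerivAt (fun r : ℝ => (r : ℂ) * e) e r := by
      simpa using (Complex.ofRealCLM.hasDerivAt (x := r)).mul_const e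
    exact (hP _).comp r h1
  rw [id, intervalIntegral.integral_eq_sub_of_hasDerivAt (fun r _ => hd r)
    (hc.intervalIntegrable _ _)]
  simp

-- A path asymptotic to a ray has the same limit of the primitive as the ray: on the disc of radius
-- `R/20` about `R e` the integrand is at most `e^(-2R)`, while the displacement is at most `R ≤
-- e^R`.
open scoped Pointwise in
theorem tendsto_primitive_path {z e : ℂ} (he : e ^ 3 = -1) (he' : ‖e‖ = 1) {P : ℂ → ℂ}
    (hP : ∀ ξ, HasDerivAt P (Complex.exp (-z * ξ + ξ ^ 3 / 3)) ξ) {ζ : ℝ → ℂ} {R : ℝ → ℝ}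
    (hR : Tendsto R atTop atTop) (hζ : Tendsto (fun t => ζ t / R t) atTop (𝓝 e)) :
    Tendsto (fun t => P (ζ t)) atTop (𝓝 (P 0 + ∫ r in Set.Ioi (0 : ℝ),
      Complex.exp (-z * (r * e) + (r * e) ^ 3 / 3) * e)) := by
  have h1 := (tendsto_primitive_ray he he' hP).comp hR
  have h2 : Tendsto (fun t => P (ζ t) - P (R t * e)) atTop (𝓝 0) := by
    have hexp : Tendsto (fun t => Real.exp (-R t)) atTop (𝓝 0) :=
      Real.tendsto_exp_neg_atTop_nhds_zero.comp hR
    refine squeeze_zero_norm' ?_ hexp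
    filter_upwards [hR.eventually (eventually_le_sq (12 * ‖z‖ + 12)), hR.eventually_gt_atTop 0,
      hζ.eventually (Metric.closedBall_mem_nhds e (by norm_num : (0 : ℝ) < 1 / 20))] with t h3 h4 h5
    rw [dist_eq_norm] at h5
    have hRc : (R t : ℂ) ≠ 0 := by exact_mod_cast h4.ne'
    set s : Set ℂ := (fun w : ℂ => (R t : ℂ) * w) '' Metric.closedBall e (1 / 20) with hs
    have hconv : Convex ℝ s := by
      have : s = (R t) • Metric.closedBall e (1 / 20) := by
        ext w
        simp [hs, Set.mem_smul_set]
      rw [this]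
      exact (convex_closedBall e (1 / 20)).smul _
    have hb : ∀ ξ ∈ s, ‖Complex.exp (-z * ξ + ξ ^ 3 / 3)‖ ≤ Real.exp (-(2 * R t)) := by
      rintro _ ⟨w, hw, rfl⟩
      rw [mem_closedBall_iff_norm] at hw
      have := norm_airy_integrand_le he he' hw h3 h4.le
      rwa [add_sub_cancel] at this
    have hm1 : ζ t ∈ s := ⟨ζ t / R t, mem_closedBall_iff_norm.2 h5, mul_div_cancel₀ _ hRc⟩
    have hm2 : R t * e ∈ s := ⟨e, by simp, rfl⟩
    have h6 := hconv.norm_image_sub_le_of_norm_hasDerivWithin_le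
      (fun ξ _ => (hP ξ).hasDerivWithinAt) hb hm2 hm1
    have h7 : ‖ζ t - R t * e‖ ≤ R t := by
      have : ζ t - R t * e = R t * (ζ t / R t - e) := by
        field_simp
      rw [this, norm_mul, Complex.norm_real, Real.norm_of_nonneg h4.le]
      nlinarith
    have h8 : R t ≤ Real.exp (R t) := by linarith [Real.add_one_le_exp (R t)]
    calc _ ≤ _ := h6
      _ ≤ Real.exp (-(2 * R t)) * Real.exp (R t) := by
        gcongr
        exact h7.trans h8
      _ = Real.exp (-R t) := by
        rw [← Real.exp_add]
        congr 1
        ring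
  simpa using h2.add h1

/-! ### Bounds for the kernel -/

theorem norm_cosh_le (z : ℂ) : ‖Complex.cosh z‖ ≤ Real.cosh z.re := by
  rw [Complex.cosh, norm_div, Complex.norm_ofNat, Real.cosh_eq]
  gcongr
  refine (norm_add_le _ _).trans ?_
  rw [Complex.norm_exp, Complex.norm_exp, Complex.neg_re]

theorem abs_sinh_le_norm_cosh (z : ℂ) : |Real.sinh z.re| ≤ ‖Complex.cosh z‖ := by
  rw [Complex.cosh, norm_div, Complex.norm_ofNat, Real.sinh_eq, abs_div, abs_two]
  gcongr
  have := abs_norm_sub_norm_le (Complex.exp z) (-Complex.exp (-z))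
  rwa [norm_neg, Complex.norm_exp, Complex.norm_exp, Complex.neg_re, sub_neg_eq_add] at this

/-- With `L = arsinh σ`, both `|cosh (2L/3)| ≤ cosh (Re L)` and `|sinh (Re L)| ≤ |cosh L|` hold, and
`|cosh L|² = |1 + σ²|`. -/
theorem norm_borelKernel_sq_le {σ : ℂ} (h : 1 + σ ^ 2 ≠ 0) :
    ‖borelKernel σ‖ ^ 2 ≤ 1 + 1 / ‖1 + σ ^ 2‖ := by
  have h0 : 0 < ‖1 + σ ^ 2‖ := norm_pos_iff.2 h
  have h1 : ‖coshArsinh σ‖ ^ 2 = ‖1 + σ ^ 2‖ := by rw [← norm_pow, coshArsinh_sq]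
  have h2 : ‖Complex.cosh (2 / 3 * arsinhC σ)‖ ≤ Real.cosh (arsinhC σ).re := by
    refine (norm_cosh_le _).trans ?_
    rw [Real.cosh_le_cosh]
    have : (2 / 3 * arsinhC σ : ℂ) = ((2 / 3 : ℝ) : ℂ) * arsinhC σ := by push_cast; ring
    rw [this, Complex.re_ofReal_mul, abs_mul, abs_of_pos (by norm_num : (0 : ℝ) < 2 / 3)]
    linarith [abs_nonneg (arsinhC σ).re]
  have h3 : Real.cosh (arsinhC σ).re ^ 2 ≤ ‖1 + σ ^ 2‖ + 1 := by
    have := abs_sinh_le_norm_cosh (arsinhC σ)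
    rw [cosh_arsinhC] at this
    rw [Real.cosh_sq, ← h1, ← sq_abs (Real.sinh _)]
    gcongr
  rw [borelKernel, norm_div, div_pow, h1, div_le_iff₀ h0]
  calc _ ≤ Real.cosh (arsinhC σ).re ^ 2 := by gcongr
    _ ≤ _ := h3
    _ = _ := by field_simp

/-! ### The steepest descent paths -/

/-- The admissible fourth roots `v` of the independent variable. -/
def Admissible (v : ℂ) : Prop := v ≠ 0 ∧ |v.arg| < π / 6 ∧ v.arg ≠ 0

/-- The argument of the kernel at the distance `t` from the singularity. -/
def rayPoint (v : ℂ) (t : ℝ) : ℂ := (√3 / 2 : ℝ) * (v ^ 3)⁻¹ * (√t : ℝ)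

theorem ofReal_sqrt_three_sq : ((√3 : ℝ) : ℂ) ^ 2 = 3 := by
  rw [← Complex.ofReal_pow, Real.sq_sqrt (by norm_num)]
  norm_num

theorem rayPoint_sq {v : ℂ} {t : ℝ} (ht : 0 ≤ t) :
    rayPoint v t ^ 2 = t * (3 / 4 * (v ^ 6)⁻¹) := by
  have h : ((√t : ℝ) : ℂ) ^ 2 = t := by
    rw [← Complex.ofReal_pow, Real.sq_sqrt ht]
  have h' := ofReal_sqrt_three_sq
  rw [rayPoint, mul_pow, mul_pow, h, inv_pow, ← pow_mul]
  push_cast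
  linear_combination (v ^ 6)⁻¹ * t / 4 * h'

theorem exp_log_of_admissible {v : ℂ} (hv : Admissible v) (n : ℕ) :
    (v ^ n)⁻¹ = Complex.exp (-(n * Complex.log v)) := by
  rw [Complex.exp_neg, Complex.exp_nat_mul, Complex.exp_log hv.1]

theorem im_natCast_mul_log (n : ℕ) (v : ℂ) : (n * Complex.log v).im = n * v.arg := by
  simp [Complex.mul_im, Complex.log_im]

theorem Admissible.re_pos {v : ℂ} (hv : Admissible v) : 0 < ((v ^ 3)⁻¹).re := by
  rw [exp_log_of_admissible hv, Complex.exp_re]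
  refine mul_pos (Real.exp_pos _) (Real.cos_pos_of_mem_Ioo ?_)
  have := abs_lt.1 hv.2.1
  rw [Complex.neg_im, im_natCast_mul_log]
  push_cast
  constructor <;> linarith

theorem Admissible.im_ne_zero {v : ℂ} (hv : Admissible v) : (3 / 4 * (v ^ 6)⁻¹).im ≠ 0 := by
  have : (3 / 4 * (v ^ 6)⁻¹ : ℂ) = ((3 / 4 : ℝ) : ℂ) * (v ^ 6)⁻¹ := by push_cast; ring
  rw [this, Complex.im_ofReal_mul, exp_log_of_admissible hv, Complex.exp_im]
  refine mul_ne_zero (by norm_num) (mul_ne_zero (Real.exp_pos _).ne' ?_)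
  have := abs_lt.1 hv.2.1
  rw [Complex.neg_im, im_natCast_mul_log, Real.sin_neg]
  push_cast
  rw [neg_ne_zero, Ne, Real.sin_eq_zero_iff_of_lt_of_lt (by linarith) (by linarith)]
  have := hv.2.2
  simpa using this

theorem rayPoint_mem_slitDomain {v : ℂ} (hv : Admissible v) {t : ℝ} (ht : 0 ≤ t) :
    rayPoint v t ∈ slitDomain := by
  rcases ht.eq_or_lt with rfl | ht'
  · exact Or.inl (by simp [rayPoint])
  · refine Or.inr ?_
    rw [rayPoint_sq ht, Complex.add_im, Complex.im_ofReal_mul]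
    simpa using ⟨ht'.ne', by simpa using hv.im_ne_zero⟩

theorem exists_norm_borelKernel_le {v : ℂ} (hv : Admissible v) :
    ∃ K : ℝ, ∀ t : ℝ, 0 ≤ t → ‖borelKernel (rayPoint v t)‖ ≤ K := by
  set w := 3 / 4 * (v ^ 6)⁻¹ with hw
  have hw0 := hv.im_ne_zero
  have hwn : 0 < ‖w‖ := by
    rw [norm_pos_iff]
    intro h
    rw [← hw, h] at hw0
    simp at hw0
  refine ⟨√(1 + ‖w‖ / |w.im|), fun t ht => Real.le_sqrt_of_sq_le ?_⟩
  have hs := Complex.slitPlane_ne_zero (rayPoint_mem_slitDomain hv ht)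
  refine (norm_borelKernel_sq_le hs).trans ?_
  rw [rayPoint_sq ht, ← hw] at hs ⊢
  refine add_le_add_right ?_ 1
  -- Multiplying by the conjugate of `w` makes the `t`-term real, so the imaginary part bounds `1 +
  -- t w` away from zero uniformly in `t`.
  have h1 : |w.im| ≤ ‖(1 + t * w) * (starRingEnd ℂ) w‖ := by
    refine le_trans (le_of_eq ?_) (Complex.abs_im_le_norm _)
    have : (1 + t * w) * (starRingEnd ℂ) w = (starRingEnd ℂ) w + ((t * Complex.normSq w : ℝ) : ℂ) := by
      push_cast
      rw [← Complex.mul_conj]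
      ring
    rw [this, Complex.add_im, Complex.conj_im, Complex.ofReal_im, add_zero, abs_neg]
  rw [norm_mul, Complex.norm_conj] at h1
  rw [div_le_div_iff₀ (norm_pos_iff.2 hs) (abs_pos.2 hw0), one_mul]
  linarith

theorem hasDerivAt_rayPoint (v : ℂ) {t : ℝ} (ht : 0 < t) :
    HasDerivAt (rayPoint v) ((√3 / 2 : ℝ) * (v ^ 3)⁻¹ * (1 / (2 * √t) : ℝ)) t :=
  ((Real.hasDerivAt_sqrt ht.ne').ofReal_comp).const_mul _

theorem continuous_rayPoint (v : ℂ) : Continuous (rayPoint v) := by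
  unfold rayPoint
  fun_prop

/-- The steepest descent paths from the saddle point `v ^ 2`, for `s = 1` and `s = -1`. -/
def descentPath (v s : ℂ) (t : ℝ) : ℂ :=
  v ^ 2 * (Complex.cosh (2 / 3 * arsinhC (rayPoint v t))
    + s * (Complex.I * (√3 : ℝ)) * Complex.sinh (2 / 3 * arsinhC (rayPoint v t)))

theorem continuousOn_descentPath {v : ℂ} (hv : Admissible v) (s : ℂ) :
    ContinuousOn (descentPath v s) (Set.Ici 0) := by
  have h : ContinuousOn (fun t => arsinhC (rayPoint v t)) (Set.Ici 0) := by
    intro t ht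
    exact ((hasDerivAt_arsinhC (rayPoint_mem_slitDomain hv ht)).continuousAt.comp
      (continuous_rayPoint v).continuousAt).continuousWithinAt
  unfold descentPath
  fun_prop

theorem hasDerivAt_descentPath {v : ℂ} (hv : Admissible v) (s : ℂ) {t : ℝ} (ht : 0 < t) :
    HasDerivAt (descentPath v s)
      (v ^ 2 * ((Complex.sinh (2 / 3 * arsinhC (rayPoint v t))
        + s * (Complex.I * (√3 : ℝ)) * Complex.cosh (2 / 3 * arsinhC (rayPoint v t))) *
        (2 / 3 * (1 / coshArsinh (rayPoint v t) *
          ((√3 / 2 : ℝ) * (v ^ 3)⁻¹ * (1 / (2 * √t) : ℝ)))))) t := by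
  have h1 : HasDerivAt (fun t => 2 / 3 * arsinhC (rayPoint v t)) (2 / 3 * (1 / coshArsinh (rayPoint v t) *
          ((√3 / 2 : ℝ) * (v ^ 3)⁻¹ * (1 / (2 * √t) : ℝ)))) t :=
    ((hasDerivAt_arsinhC (rayPoint_mem_slitDomain hv ht.le)).comp t
      (hasDerivAt_rayPoint v ht)).const_mul _
  have h2 := (Complex.hasDerivAt_cosh _).comp t h1
  have h3 := (Complex.hasDerivAt_sinh _).comp t h1
  refine ((h2.add (h3.const_mul (s * (Complex.I * (√3 : ℝ))))).const_mul (v ^ 2)).congr_deriv ?_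
  ring

/-- The path is `2 v² cosh (2L/3 + s iπ/3)` with `L = arsinh σ`; the triple angle formula turns the
cubic into `-(2/3) v⁶ cosh (2L) = -(2/3) v⁶ (1 + 2σ²)`. -/
theorem descentPath_exponent {v s : ℂ} (hv : v ≠ 0) (hs : s ^ 2 = 1) {t : ℝ} (ht : 0 ≤ t) :
    -v ^ 4 * descentPath v s t + descentPath v s t ^ 3 / 3 = -(2 / 3 * v ^ 6 + t) := by
  set L := arsinhC (rayPoint v t) with hL
  have h1 : Complex.cosh (3 * (2 / 3 * L)) = 1 + 2 * rayPoint v t ^ 2 := by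
    have : 3 * (2 / 3 * L) = 2 * L := by ring
    rw [this, Complex.cosh_two_mul, hL, cosh_arsinhC, sinh_arsinhC, coshArsinh_sq]
    ring
  rw [Complex.cosh_three_mul, rayPoint_sq ht] at h1
  have h2 := Complex.cosh_sq_sub_sinh_sq (2 / 3 * L)
  rw [descentPath, ← hL]
  set c := Complex.cosh (2 / 3 * L)
  set S := Complex.sinh (2 / 3 * L)
  have h3 := ofReal_sqrt_three_sq
  set q : ℂ := ((√3 : ℝ) : ℂ)
  have hI := Complex.I_sq
  have hJ : (s * (Complex.I * q)) ^ 2 = -3 := by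
    rw [mul_pow, mul_pow, hs, hI, h3]
    ring
  set J := s * (Complex.I * q)
  have hv6 : v ^ 6 * (v ^ 6)⁻¹ = 1 := mul_inv_cancel₀ (pow_ne_zero 6 hv)
  linear_combination (-2 / 3 * v ^ 6) * h1 - t * hv6
    + v ^ 6 * (c * S ^ 2 + J * S ^ 3 / 3) * hJ + v ^ 6 * (3 * c + J * S) * h2

/-! ### Directions of the descent paths at infinity -/

theorem exp_two_thirds_log {v : ℂ} (hv : Admissible v) :
    Complex.exp (2 / 3 * Complex.log ((v ^ 3)⁻¹)) = (v ^ 2)⁻¹ := by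
  have := abs_lt.1 hv.2.1
  rw [exp_log_of_admissible hv, exp_log_of_admissible hv, Complex.log_exp]
  · congr 1
    push_cast
    ring
  · rw [Complex.neg_im, im_natCast_mul_log]
    push_cast
    linarith
  · rw [Complex.neg_im, im_natCast_mul_log]
    push_cast
    linarith

/-- The scaled `σ` equals `a = v⁻³/2`, and the scaled root `w` satisfies `(w - a)(w + a) = 1/(3t)`.
Both have positive real part, so `|w + a| ≥ Re a`, which forces `w → a` rather than `-a`. -/
theorem tendsto_add_coshArsinh_div {v : ℂ} (hv : Admissible v) :
    Tendsto (fun t : ℝ => (rayPoint v t + coshArsinh (rayPoint v t)) / (√(3 * t) : ℝ)) atTop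
      (𝓝 (v ^ 3)⁻¹) := by
  set a := (v ^ 3)⁻¹ / 2 with ha
  have hre : 0 < a.re := by
    have := hv.re_pos
    rw [ha, Complex.div_ofNat_re]
    linarith
  rw [tendsto_iff_norm_sub_tendsto_zero]
  have hlim : Tendsto (fun t : ℝ => (3 * t)⁻¹ / a.re) atTop (𝓝 0) := by
    have : Tendsto (fun t : ℝ => (3 * t)⁻¹) atTop (𝓝 0) :=
      tendsto_inv_atTop_zero.comp (tendsto_id.const_mul_atTop (by norm_num))
    simpa using this.div_const a.re
  refine squeeze_zero' (Eventually.of_forall fun _ => norm_nonneg _) ?_ hlim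
  filter_upwards [eventually_gt_atTop 0] with t ht
  have hs : 0 < √(3 * t) := Real.sqrt_pos.2 (by positivity)
  have hsc : ((√(3 * t) : ℝ) : ℂ) ≠ 0 := by exact_mod_cast hs.ne'
  have hs2 : ((√(3 * t) : ℝ) : ℂ) ^ 2 = 3 * t := by
    rw [← Complex.ofReal_pow, Real.sq_sqrt (by positivity)]
    push_cast
    ring
  set w := coshArsinh (rayPoint v t) / (√(3 * t) : ℝ) with hw
  have h1 : rayPoint v t / (√(3 * t) : ℝ) = a := by
    rw [div_eq_iff hsc, rayPoint, ha, Real.sqrt_mul (by norm_num)]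
    push_cast
    ring
  have htc : (t : ℂ) ≠ 0 := by exact_mod_cast ht.ne'
  have h2 : w ^ 2 - a ^ 2 = ((3 * t)⁻¹ : ℝ) := by
    rw [hw, div_pow, coshArsinh_sq, rayPoint_sq ht.le, hs2, ha]
    have := pow_ne_zero 6 hv.1
    have hv0 := hv.1
    push_cast
    field_simp
    ring
  have hwre : 0 < w.re := by
    rw [hw, Complex.div_ofReal_re]
    exact div_pos (coshArsinh_re_pos (rayPoint_mem_slitDomain hv ht.le)) hs
  have h3 : (rayPoint v t + coshArsinh (rayPoint v t)) / (√(3 * t) : ℝ) - (v ^ 3)⁻¹ = w - a := by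
    rw [add_div, h1, ← hw, ha]
    ring
  rw [h3, le_div_iff₀ hre]
  have h4 : ‖w - a‖ * ‖w + a‖ = (3 * t)⁻¹ := by
    rw [← norm_mul, show (w - a) * (w + a) = w ^ 2 - a ^ 2 by ring, h2, Complex.norm_real,
      Real.norm_of_nonneg (by positivity)]
  rw [← h4]
  gcongr
  refine le_trans ?_ (Complex.re_le_norm _)
  rw [Complex.add_re]
  linarith

theorem tendsto_exp_arsinhC_div {v : ℂ} (hv : Admissible v) :
    Tendsto (fun t : ℝ => Complex.exp (2 / 3 * arsinhC (rayPoint v t)) /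
      (Real.exp (2 / 3 * Real.log √(3 * t)) : ℝ)) atTop (𝓝 (v ^ 2)⁻¹) := by
  have h1 := ((tendsto_add_coshArsinh_div hv).clog (Or.inl hv.re_pos)).const_mul (2 / 3)
  have h2 := (Complex.continuous_exp.tendsto _).comp h1
  rw [exp_two_thirds_log hv] at h2
  refine h2.congr' ?_
  filter_upwards [eventually_gt_atTop 0] with t ht
  have hs : 0 < √(3 * t) := Real.sqrt_pos.2 (by positivity)
  have hsc : ((√(3 * t) : ℝ) : ℂ) ≠ 0 := by exact_mod_cast hs.ne'
  have h0 := add_coshArsinh_ne_zero (rayPoint v t)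
  rw [Function.comp, Complex.ofReal_exp, ← Complex.exp_sub, arsinhC]
  congr 1
  have h3 := Complex.log_ofReal_mul hs (div_ne_zero h0 hsc)
  rw [mul_div_cancel₀ _ hsc] at h3
  rw [h3]
  push_cast
  ring

theorem tendsto_exp_log_sqrt :
    Tendsto (fun t : ℝ => Real.exp (2 / 3 * Real.log √(3 * t))) atTop atTop := by
  refine Real.tendsto_exp_atTop.comp (Tendsto.const_mul_atTop (by norm_num) ?_)
  exact Real.tendsto_log_atTop.comp (Real.tendsto_sqrt_atTop.comp
    (tendsto_id.const_mul_atTop (by norm_num)))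

/-- At the scale `(3t)^{1/3}` only `e^{2L/3} ~ v⁻² (3t)^{1/3}` survives; its factor `v⁻²` cancels
the `v²` in front of the path, so the direction does not depend on `v`. -/
theorem tendsto_descentPath_div {v : ℂ} (hv : Admissible v) (s : ℂ) :
    Tendsto (fun t : ℝ => descentPath v s t / (Real.exp (2 / 3 * Real.log √(3 * t)) : ℝ)) atTop
      (𝓝 ((1 + s * (Complex.I * (√3 : ℝ))) / 2)) := by
  have h1 := tendsto_exp_arsinhC_div hv
  have hv2 : v ^ 2 ≠ 0 := pow_ne_zero 2 hv.1
  have hR : Tendsto (fun t : ℝ => ((Real.exp (2 / 3 * Real.log √(3 * t)) : ℝ) : ℂ)⁻¹) atTop (𝓝 0) := by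
    have := (Complex.continuous_ofReal.tendsto 0).comp (tendsto_inv_atTop_zero.comp tendsto_exp_log_sqrt)
    simpa [Function.comp_def] using this
  have h2 := (h1.inv₀ (inv_ne_zero hv2)).mul (hR.pow 2)
  have h3 := ((h1.mul_const ((1 + s * (Complex.I * (√3 : ℝ))) / 2)).add
    (h2.mul_const ((1 - s * (Complex.I * (√3 : ℝ))) / 2))).const_mul (v ^ 2)
  have h4 : v ^ 2 * ((v ^ 2)⁻¹ * ((1 + s * (Complex.I * (√3 : ℝ))) / 2) +
      ((v ^ 2)⁻¹)⁻¹ * 0 ^ 2 * ((1 - s * (Complex.I * (√3 : ℝ))) / 2)) =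
      (1 + s * (Complex.I * (√3 : ℝ))) / 2 := by
    have hv0 := hv.1
    field_simp
    ring
  rw [h4] at h3
  refine h3.congr fun t => ?_
  have hr : ((Real.exp (2 / 3 * Real.log √(3 * t)) : ℝ) : ℂ) ≠ 0 := by
    exact_mod_cast (Real.exp_pos _).ne'
  rw [descentPath, Complex.cosh, Complex.sinh, Complex.exp_neg]
  generalize ((Real.exp (2 / 3 * Real.log √(3 * t)) : ℝ) : ℂ) = r at hr ⊢
  have he := Complex.exp_ne_zero (2 / 3 * arsinhC (rayPoint v t))
  generalize Complex.exp (2 / 3 * arsinhC (rayPoint v t)) = E at he ⊢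
  field_simp
  ring

/-! ### The saddle point integral -/

theorem exp_pi_div_three (s : ℝ) (hs : s = 1 ∨ s = -1) :
    Complex.exp (((s * (π / 3) : ℝ) : ℂ) * Complex.I) =
      (1 + s * (Complex.I * (√3 : ℝ))) / 2 := by
  rw [Complex.exp_mul_I, ← Complex.ofReal_cos, ← Complex.ofReal_sin]
  rcases hs with rfl | rfl
  · rw [one_mul, Real.cos_pi_div_three, Real.sin_pi_div_three]
    push_cast
    ring
  · rw [neg_one_mul, Real.cos_neg, Real.sin_neg, Real.cos_pi_div_three, Real.sin_pi_div_three]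
    push_cast
    ring

theorem tendsto_primitive_descentPath {v : ℂ} (hv : Admissible v) {P : ℂ → ℂ}
    (hP : ∀ ξ, HasDerivAt P (Complex.exp (-v ^ 4 * ξ + ξ ^ 3 / 3)) ξ) {s : ℝ}
    (hs : s = 1 ∨ s = -1) :
    Tendsto (fun t => P (descentPath v s t)) atTop (𝓝 (P 0 + airyRay (s * (π / 3)) (v ^ 4))) := by
  refine tendsto_primitive_path ?_ (Complex.norm_exp_ofReal_mul_I _) hP tendsto_exp_log_sqrt ?_
  · rw [← Complex.exp_nat_mul]
    rcases hs with rfl | rfl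
    · rw [← Complex.exp_pi_mul_I]
      congr 1
      push_cast
      ring
    · rw [← inv_inj, ← Complex.exp_neg, inv_neg, inv_one, ← Complex.exp_pi_mul_I]
      congr 1
      push_cast
      ring
  · rw [exp_pi_div_three s hs]
    exact tendsto_descentPath_div hv s

/-- The Laplace integrand along the ray, for large parameter one. -/
def saddleIntegrand (v : ℂ) (t : ℝ) : ℂ :=
  Complex.exp (-(2 / 3 * v ^ 6 + t)) * (borelKernel (rayPoint v t) / (√t : ℝ))

theorem integrableOn_saddleIntegrand {v : ℂ} (hv : Admissible v) :
    IntegrableOn (saddleIntegrand v) (Set.Ioi 0) := by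
  obtain ⟨K, hK⟩ := exists_norm_borelKernel_le hv
  -- The kernel is bounded on the ray, so `t^(-1/2) e^(-t)` dominates up to a constant.
  have hG := (Real.GammaIntegral_convergent (s := 1 / 2) (by norm_num)).const_mul
    (Real.exp (-(2 / 3 * v ^ 6)).re * K)
  refine Integrable.mono' hG ?_ ?_
  · refine ContinuousOn.aestronglyMeasurable ?_ measurableSet_Ioi
    have h1 : ContinuousOn (fun t => borelKernel (rayPoint v t)) (Set.Ioi 0) := by
      intro t ht
      exact ((hasDerivAt_borelKernel (rayPoint_mem_slitDomain hv ht.out.le)).continuousAt.comp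
        (continuous_rayPoint v).continuousAt).continuousWithinAt
    refine ContinuousOn.mul (by fun_prop) (h1.div (by fun_prop) fun t ht => ?_)
    exact_mod_cast (Real.sqrt_pos.2 ht).ne'
  · refine (ae_restrict_mem measurableSet_Ioi).mono fun t ht => ?_
    have ht' : 0 < √t := Real.sqrt_pos.2 ht
    rw [saddleIntegrand, norm_mul, Complex.norm_exp, norm_div, Complex.norm_real,
      Real.norm_of_nonneg ht'.le, neg_add, Complex.add_re, Real.exp_add, Complex.neg_re (t : ℂ),
      Complex.ofReal_re]
    have h2 : t ^ (1 / 2 - 1 : ℝ) = 1 / √t := by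
      rw [Real.rpow_sub ht, Real.rpow_one, ← Real.sqrt_eq_rpow, div_eq_div_iff ht.out.ne' ht'.ne',
        Real.mul_self_sqrt ht.out.le, one_mul]
    rw [h2]
    calc _ ≤ Real.exp (-(2 / 3 * v ^ 6)).re * Real.exp (-t) * (K / √t) := by
          gcongr
          exact hK t ht.out.le
      _ = _ := by ring

/-- Along both paths the Airy exponential is the same function of `t`, so subtraction only affects
the velocities: the `sinh` terms cancel and the `cosh` terms give `i/v` times the kernel over `√t`.
-/
theorem integral_saddleIntegrand {v : ℂ} (hv : Admissible v) :
    ∫ t in Set.Ioi (0 : ℝ), saddleIntegrand v t = v / Complex.I * airyContour₁ (v ^ 4) := by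
  obtain ⟨P, hP⟩ := exists_airy_primitive (v ^ 4)
  have hv0 := hv.1
  have hPc : Continuous P := continuous_iff_continuousAt.2 fun ξ => (hP ξ).continuousAt
  have hlim := ((tendsto_primitive_descentPath hv hP (Or.inl rfl)).sub
    (tendsto_primitive_descentPath hv hP (Or.inr rfl))).const_mul (v / Complex.I)
  have hcont : ContinuousOn (fun t => v / Complex.I *
      (P (descentPath v (1 : ℝ) t) - P (descentPath v (-1 : ℝ) t))) (Set.Ici 0) :=
    ((hPc.comp_continuousOn (continuousOn_descentPath hv _)).sub
      (hPc.comp_continuousOn (continuousOn_descentPath hv _))).const_smul (v / Complex.I)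
  rw [integral_Ioi_of_hasDerivAt_of_tendsto (hcont 0 Set.self_mem_Ici) ?_
    (integrableOn_saddleIntegrand hv) hlim]
  -- Both paths start at the saddle `v²`, so the boundary term at `t = 0` vanishes.
  · simp [airyContour₁, descentPath, rayPoint, arsinhC_zero]
  · intro t ht
    have h1 := (hP _).comp t (hasDerivAt_descentPath hv ((1 : ℝ) : ℂ) ht)
    have h2 := (hP _).comp t (hasDerivAt_descentPath hv ((-1 : ℝ) : ℂ) ht)
    refine ((h1.sub h2).const_mul (v / Complex.I)).congr_deriv ?_
    rw [descentPath_exponent hv0 (by simp) ht.out.le, descentPath_exponent hv0 (by simp) ht.out.le,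
      saddleIntegrand, borelKernel]
    have h3 := ofReal_sqrt_three_sq
    have h4 := coshArsinh_ne_zero (rayPoint_mem_slitDomain hv ht.out.le)
    have h5 : ((√t : ℝ) : ℂ) ≠ 0 := by exact_mod_cast (Real.sqrt_pos.2 ht).ne'
    have hI := Complex.I_ne_zero
    push_cast
    generalize ((√3 : ℝ) : ℂ) = q at *
    generalize ((√t : ℝ) : ℂ) = r at *
    generalize coshArsinh (rayPoint v t) = w at *
    field_simp
    linear_combination (2 * Complex.I * Complex.cosh (2 * arsinhC (rayPoint v t) / 3)) * h3

end

section

open Filter Topology MeasureTheory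

/-! ### The Borel transforms of the WKB solutions -/

theorem cpow_div_four (x : ℂ) (n : ℕ) : (x ^ (1 / 4 : ℂ)) ^ n = x ^ (n / 4 : ℂ) := by
  rw [← Complex.cpow_nat_mul]
  congr 1
  ring

theorem cpow_half (x : ℂ) : x ^ (1 / 2 : ℂ) = (x ^ (1 / 4 : ℂ)) ^ 2 := by
  rw [cpow_div_four]
  norm_num

theorem cpow_three_halves (x : ℂ) : x ^ (3 / 2 : ℂ) = (x ^ (1 / 4 : ℂ)) ^ 6 := by
  rw [cpow_div_four]
  norm_num

theorem cpow_quarter_pow_four (x : ℂ) : (x ^ (1 / 4 : ℂ)) ^ 4 = x := by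
  rw [cpow_div_four]
  norm_num

theorem cpow_neg_quarter (x : ℂ) : x ^ (-1 / 4 : ℂ) = (x ^ (1 / 4 : ℂ))⁻¹ := by
  rw [← Complex.cpow_neg]
  norm_num

/-- The Taylor coefficients of the kernel in the variable `σ ^ 2`. -/
def kernelCoeff (n : ℕ) : ℂ :=
  ∏ k ∈ Finset.range n, -((k + 1 / 6 : ℂ) * (k + 5 / 6) / ((k + 1) * (k + 1 / 2)))

theorem kernelCoeff_succ (n : ℕ) : kernelCoeff (n + 1) =
    -((n + 1 / 6) * (n + 5 / 6) / ((n + 1) * (n + 1 / 2))) * kernelCoeff n := by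
  rw [kernelCoeff, Finset.prod_range_succ, mul_comm, kernelCoeff]

theorem Gamma_half : Complex.Gamma (1 / 2) = (√π : ℝ) := by
  rw [Complex.Gamma_one_half_eq, Real.sqrt_eq_rpow, Complex.ofReal_cpow Real.pi_pos.le]
  norm_num

/-- `Γ (n + 3/2) = (n + 1/2) Γ (n + 1/2)` supplies the missing factor in the denominator of the
kernel recurrence; `√π` is `Γ (1/2)`. -/
theorem coeff_wkbSeries_div_Gamma {ε x v' : ℂ} (hε : ε ^ 2 = 1) (hx : x ≠ 0)
    (hv' : v' ^ 6 = -ε * (x ^ (1 / 4 : ℂ)) ^ 6) (n : ℕ) :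
    PowerSeries.coeff n (wkbSeries ε x) / Complex.Gamma (n + 1 / 2) =
      ((√π : ℝ) : ℂ)⁻¹ * (kernelCoeff n * (3 / 4 * (v' ^ 6)⁻¹) ^ n) := by
  induction n with
  | zero =>
    simp only [PowerSeries.coeff_zero_eq_constantCoeff, constantCoeff_wkbSeries, Nat.cast_zero,
      zero_add, Gamma_half, kernelCoeff, Finset.range_zero, Finset.prod_empty, pow_zero]
    ring
  | succ n ih =>
    have h1 : (n : ℂ) + 1 / 2 ≠ 0 := by
      intro h
      have := congrArg Complex.re h
      simp only [Complex.add_re, Complex.natCast_re, Complex.zero_re] at this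
      norm_num at this
      have := n.cast_nonneg (α := ℝ)
      linarith
    have h2 : ((n + 1 : ℕ) : ℂ) + 1 / 2 = (n + 1 / 2) + 1 := by
      push_cast
      ring
    have h3 : (n : ℂ) + 1 ≠ 0 := by exact_mod_cast n.succ_ne_zero
    have hv0 : x ^ (1 / 4 : ℂ) ≠ 0 := by simp [Complex.cpow_eq_zero_iff, hx]
    have hε0 : ε ≠ 0 := by
      rintro rfl
      simp at hε
    have h4 : (v' ^ 6)⁻¹ = -ε * (x ^ (1 / 2 : ℂ)) ^ (-3 : ℤ) := by
      rw [hv', cpow_half]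
      field_simp
      rw [hε]
    rw [h2, Complex.Gamma_add_one _ h1, coeff_succ_wkbSeries hε hx, kernelCoeff_succ, pow_succ,
      mul_div_mul_comm, ih]
    generalize (3 / 4 * (v' ^ 6)⁻¹) ^ n = K
    rw [h4]
    simp only [div_eq_mul_inv, mul_inv]
    ring

/-- The analytic factor of the Borel transform, as a function of the distance from the
singularity. -/
def borelFactor (v v' y : ℂ) : ℂ :=
  v⁻¹ * ((√π : ℝ) : ℂ)⁻¹ * borelKernel ((√3 / 2 : ℝ) * (v' ^ 3)⁻¹ * y ^ (1 / 2 : ℂ))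

theorem hasSum_borelFactor (v v' : ℂ) : ∀ᶠ y in 𝓝 (0 : ℂ),
    HasSum (fun n => v⁻¹ * (((√π : ℝ) : ℂ)⁻¹ * (kernelCoeff n * (3 / 4 * (v' ^ 6)⁻¹) ^ n)) * y ^ n)
      (borelFactor v v' y) := by
  have hsq : ∀ y : ℂ, ((√3 / 2 : ℝ) * (v' ^ 3)⁻¹ * y ^ (1 / 2 : ℂ)) ^ 2 =
      3 / 4 * (v' ^ 6)⁻¹ * y := by
    intro y
    have h1 : (y ^ (1 / 2 : ℂ)) ^ 2 = y := by
      rw [← Complex.cpow_nat_mul]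
      norm_num
    rw [mul_pow, mul_pow, h1, inv_pow, ← pow_mul]
    push_cast
    rw [div_pow, ofReal_sqrt_three_sq]
    norm_num
  have hlim : Tendsto (fun y : ℂ => ‖3 / 4 * (v' ^ 6)⁻¹ * y‖) (𝓝 0) (𝓝 0) := by
    have : Continuous fun y : ℂ => ‖3 / 4 * (v' ^ 6)⁻¹ * y‖ := by fun_prop
    simpa using this.tendsto 0
  filter_upwards [hlim.eventually_lt_const one_pos] with y hy
  have hσ : ‖(√3 / 2 : ℝ) * (v' ^ 3)⁻¹ * y ^ (1 / 2 : ℂ)‖ < 1 := by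
    rw [← hsq, norm_pow] at hy
    exact (sq_lt_one_iff₀ (norm_nonneg _)).1 hy
  have h := (hasSum_borelKernel (by simp [kernelCoeff]) kernelCoeff_succ hσ).mul_left
    (v⁻¹ * ((√π : ℝ) : ℂ)⁻¹)
  refine (congrArg (fun f => HasSum f (borelFactor v v' y)) (funext fun n => ?_)).mpr h
  rw [hsq]
  ring

theorem ofReal_cpow_half {t : ℝ} (ht : 0 ≤ t) : (t : ℂ) ^ (1 / 2 : ℂ) = (√t : ℝ) := by
  rw [Real.sqrt_eq_rpow, Complex.ofReal_cpow ht]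
  norm_num

/-- At the origin the branch cut of `y^{1/2}` is harmless because the kernel has a power series in
`σ²`; for `t > 0` the square root itself is analytic. -/
theorem analyticAt_borelFactor (v : ℂ) {v' : ℂ} (hv' : Admissible v') {t : ℝ} (ht : 0 ≤ t) :
    AnalyticAt ℂ (borelFactor v v') t := by
  rcases ht.eq_or_lt with rfl | ht'
  · refine ⟨FormalMultilinearSeries.ofScalars ℂ fun n =>
      v⁻¹ * (((√π : ℝ) : ℂ)⁻¹ * (kernelCoeff n * (3 / 4 * (v' ^ 6)⁻¹) ^ n)), ?_⟩
    rw [hasFPowerSeriesAt_iff, Complex.ofReal_zero]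
    filter_upwards [hasSum_borelFactor v v'] with y hy
    rw [zero_add]
    refine (congrArg (fun f => HasSum f (borelFactor v v' y)) (funext fun n => ?_)).mpr hy
    rw [FormalMultilinearSeries.coeff_ofScalars, smul_eq_mul, mul_comm]
  · have h1 : AnalyticAt ℂ (fun y : ℂ => (√3 / 2 : ℝ) * (v' ^ 3)⁻¹ * y ^ (1 / 2 : ℂ)) t :=
      analyticAt_const.mul (analyticAt_id.cpow analyticAt_const
        (Complex.ofReal_mem_slitPlane.2 ht'))
    have h2 : AnalyticAt ℂ borelKernel ((√3 / 2 : ℝ) * (v' ^ 3)⁻¹ * (t : ℂ) ^ (1 / 2 : ℂ)) := by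
      rw [ofReal_cpow_half ht]
      exact analyticAt_borelKernel (rayPoint_mem_slitDomain hv' ht)
    exact analyticAt_const.mul (AnalyticAt.comp (g := borelKernel) h2 h1)

theorem wkb_exponent {ε x v' : ℂ} (hv' : v' ^ 6 = -ε * (x ^ (1 / 4 : ℂ)) ^ 6) :
    (wkb ε x).exponent = -(2 / 3 * v' ^ 6) := by
  rw [wkb]
  simp only [riccatiPrimitive_zero, cpow_three_halves, hv']
  ring

theorem wkb_coeff (ε x : ℂ) (n : ℕ) : (wkb ε x).coeff n =
    (x ^ (1 / 4 : ℂ))⁻¹ * PowerSeries.coeff n (wkbSeries ε x) := by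
  rw [← cpow_neg_quarter]
  rfl

theorem isBorelTransform_wkb {ε x v' : ℂ} (hε : ε ^ 2 = 1) (hx : x ≠ 0) (hA : Admissible v')
    (hv' : v' ^ 6 = -ε * (x ^ (1 / 4 : ℂ)) ^ 6) :
    IsBorelTransform (wkb ε x) fun y => (y + (wkb ε x).exponent) ^ (-1 / 2 : ℂ) *
      borelFactor (x ^ (1 / 4 : ℂ)) v' (y + (wkb ε x).exponent) := by
  refine ⟨fun y => borelFactor (x ^ (1 / 4 : ℂ)) v' (y + (wkb ε x).exponent), ?_, ?_,
    fun _ _ => rfl⟩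
  · rintro _ ⟨t, ht, rfl⟩
    have h1 : AnalyticAt ℂ (fun y => y + (wkb ε x).exponent) (-(wkb ε x).exponent + t) := by
      fun_prop
    refine AnalyticAt.comp (g := borelFactor (x ^ (1 / 4 : ℂ)) v') ?_ h1
    rw [neg_add_cancel_comm]
    exact analyticAt_borelFactor _ hA ht
  · have h1 : Tendsto (fun y => y + (wkb ε x).exponent) (𝓝 (-(wkb ε x).exponent)) (𝓝 0) := by
      have : Continuous fun y => y + (wkb ε x).exponent := by fun_prop
      simpa using this.tendsto (-(wkb ε x).exponent)
    filter_upwards [h1.eventually (hasSum_borelFactor (x ^ (1 / 4 : ℂ)) v')] with y hy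
    refine (congrArg (fun f => HasSum f _) (funext fun n => ?_)).mpr hy
    rw [wkb_coeff, mul_div_assoc, coeff_wkbSeries_div_Gamma hε hx hv']

/-! ### The Borel sums -/

theorem Admissible.ofReal_mul {v : ℂ} (hv : Admissible v) {ρ : ℝ} (hρ : 0 < ρ) :
    Admissible (ρ * v) := by
  refine ⟨mul_ne_zero (by exact_mod_cast hρ.ne') hv.1, ?_, ?_⟩ <;>
    rw [Complex.arg_real_mul _ hρ]
  exacts [hv.2.1, hv.2.2]

/-- With `η = ρ⁶`, scaling `v'` by `ρ` and `t` by `ρ⁶` leaves `σ` unchanged, which reduces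
everything to large parameter one. -/
theorem laplaceIntegrand_wkb {ε x v' : ℂ} (hv' : v' ^ 6 = -ε * (x ^ (1 / 4 : ℂ)) ^ 6)
    {ρ : ℝ} (hρ : 0 < ρ) {t : ℝ} (ht : 0 < t) :
    laplaceIntegrand (fun y => (y + (wkb ε x).exponent) ^ (-1 / 2 : ℂ) *
      borelFactor (x ^ (1 / 4 : ℂ)) v' (y + (wkb ε x).exponent)) (-(wkb ε x).exponent) (ρ ^ 6) t =
    (x ^ (1 / 4 : ℂ))⁻¹ * ((√π : ℝ) : ℂ)⁻¹ * ρ ^ 3 * saddleIntegrand (ρ * v') (ρ ^ 6 * t) := by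
  have hs : √(ρ ^ 6 * t) = ρ ^ 3 * √t := by
    rw [Real.sqrt_mul (by positivity), show ρ ^ 6 = (ρ ^ 3) ^ 2 by ring,
      Real.sqrt_sq (by positivity)]
  have hρ0 : (ρ : ℂ) ≠ 0 := by exact_mod_cast hρ.ne'
  have hr : rayPoint (ρ * v') (ρ ^ 6 * t) = (√3 / 2 : ℝ) * (v' ^ 3)⁻¹ * (√t : ℝ) := by
    rw [rayPoint, hs, mul_pow, mul_inv]
    push_cast
    field_simp
  have ht' : (t : ℂ) ^ (-1 / 2 : ℂ) = ((√t : ℝ) : ℂ)⁻¹ := by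
    rw [← ofReal_cpow_half ht.le, ← Complex.cpow_neg]
    norm_num
  have hst : ((√t : ℝ) : ℂ) ≠ 0 := by exact_mod_cast (Real.sqrt_pos.2 ht).ne'
  rw [laplaceIntegrand, neg_add_cancel_comm, borelFactor, ht', ofReal_cpow_half ht.le,
    saddleIntegrand, hr, hs, wkb_exponent hv']
  have he : -(- -(2 / 3 * v' ^ 6) + (t : ℂ)) * ((ρ ^ 6 : ℝ) : ℂ) =
      -(2 / 3 * (ρ * v') ^ 6 + ((ρ ^ 6 * t : ℝ) : ℂ)) := by
    push_cast
    ring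
  rw [he]
  push_cast
  field_simp

theorem borelSum_wkb {ε x v' : ℂ} (hε : ε ^ 2 = 1) (hx : x ≠ 0) (hA : Admissible v')
    (hv' : v' ^ 6 = -ε * (x ^ (1 / 4 : ℂ)) ^ 6) {ρ : ℝ} (hρ : 0 < ρ) :
    BorelSummable (wkb ε x) (ρ ^ 6) ∧ borelSum (wkb ε x) (ρ ^ 6) =
      ((√π : ℝ) : ℂ)⁻¹ * (v' / x ^ (1 / 4 : ℂ)) / (Complex.I * ρ ^ 2) *
        airyContour₁ (ρ ^ 4 * v' ^ 4) := by
  have hB := isBorelTransform_wkb hε hx hA hv'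
  have hA' := hA.ofReal_mul hρ
  have hρ6 : 0 < ρ ^ 6 := by positivity
  refine ⟨⟨_, hB, ?_⟩, ?_⟩
  · have h1 := integrableOn_saddleIntegrand hA'
    rw [← mul_zero (ρ ^ 6)] at h1
    have h2 := ((integrableOn_Ioi_comp_mul_left_iff _ 0 hρ6).2 h1).const_mul
      ((x ^ (1 / 4 : ℂ))⁻¹ * ((√π : ℝ) : ℂ)⁻¹ * ρ ^ 3)
    exact IntegrableOn.congr_fun h2 (fun t ht => (laplaceIntegrand_wkb hv' hρ ht).symm)
      measurableSet_Ioi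
  · rw [borelSum_eq hB, setIntegral_congr_fun measurableSet_Ioi
      fun t ht => laplaceIntegrand_wkb hv' hρ ht, integral_const_mul,
      integral_comp_mul_left_Ioi (saddleIntegrand (ρ * v')) 0 hρ6, mul_zero,
      integral_saddleIntegrand hA', mul_pow, Complex.real_smul]
    have hρ0 : (ρ : ℂ) ≠ 0 := by exact_mod_cast hρ.ne'
    push_cast
    field_simp

/-! ### Rotation of the Airy contours -/

theorem airyRay_rotate {ω : ℂ} (θ : ℝ) (hω : ω = Complex.exp ((2 * π / 3 : ℝ) * Complex.I)) (z : ℂ) :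
    airyRay (θ + 2 * π / 3) z = ω * airyRay θ (ω * z) := by
  have h3 : ω ^ 3 = 1 := by
    rw [hω, ← Complex.exp_nat_mul, ← Complex.exp_two_pi_mul_I]
    congr 1
    push_cast
    ring
  rw [airyRay, airyRay, ← integral_const_mul]
  have he : Complex.exp (((θ + 2 * π / 3 : ℝ) : ℂ) * Complex.I) =
      Complex.exp (θ * Complex.I) * ω := by
    rw [hω, ← Complex.exp_add]
    congr 1
    push_cast
    ring
  refine integral_congr_ae (Eventually.of_forall fun r => ?_)
  simp only [he]
  rw [show (r * (Complex.exp (θ * Complex.I) * ω)) ^ 3 = (r * Complex.exp (θ * Complex.I)) ^ 3 by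
    rw [← mul_assoc, mul_pow _ ω, h3, mul_one],
    show -z * (r * (Complex.exp (θ * Complex.I) * ω)) =
      -(ω * z) * (r * Complex.exp (θ * Complex.I)) by ring]
  ring

theorem airyContour₂_eq {ω : ℂ} (hω : ω = Complex.exp ((2 * π / 3 : ℝ) * Complex.I)) (z : ℂ) :
    airyContour₂ z = ω * airyContour₁ (ω * z) := by
  have h1 := airyRay_rotate (π / 3) hω z
  have h2 := airyRay_rotate (-(π / 3)) hω z
  rw [show π / 3 + 2 * π / 3 = π by ring] at h1
  rw [show -(π / 3) + 2 * π / 3 = π / 3 by ring] at h2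
  rw [airyContour₂, airyContour₁, h1, h2]
  ring

theorem airyContour₃_eq (z : ℂ) : airyContour₃ z = -airyContour₁ z - airyContour₂ z := by
  rw [airyContour₁, airyContour₂, airyContour₃]
  ring

theorem admissible_exp {w : ℂ} (h : |w.im| < π / 6) (h0 : w.im ≠ 0) :
    Admissible (Complex.exp w) := by
  have h' := abs_lt.1 h
  have : (Complex.exp w).arg = w.im := by
    rw [← Complex.log_im, Complex.log_exp (by linarith) (by linarith)]
  refine ⟨Complex.exp_ne_zero w, ?_, ?_⟩ <;> rwa [this]

end

end AiryWKB

end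

/-! ### The connection formulas in the Stokes region -/

theorem theorem6 (x : ℂ) (hx : x ∈ AiryWKB.stokesRegionI) (η : ℝ) (hη : 0 < η) :
    AiryWKB.BorelSummable (AiryWKB.wkb 1 x) η ∧
    AiryWKB.BorelSummable (AiryWKB.wkb (-1) x) η ∧
    AiryWKB.Ai (((η ^ (2 / 3 : ℝ) : ℝ) : ℂ) * x) =
      ((η ^ (1 / 3 : ℝ) : ℝ) : ℂ) * (1 / (2 * (Real.sqrt Real.pi : ℂ))) *
        AiryWKB.PsiMinus x η ∧
    AiryWKB.Bi (((η ^ (2 / 3 : ℝ) : ℝ) : ℂ) * x) =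
      ((η ^ (1 / 3 : ℝ) : ℝ) : ℂ) * (1 / (Real.sqrt Real.pi : ℂ)) * AiryWKB.PsiPlus x η -
      ((η ^ (1 / 3 : ℝ) : ℝ) : ℂ) * (Complex.I / (2 * (Real.sqrt Real.pi : ℂ))) *
        AiryWKB.PsiMinus x η := by
  obtain ⟨hx1, hx2⟩ := hx
  have hx0 : x ≠ 0 := by
    rintro rfl
    simp at hx2
  have hρ : 0 < η ^ (1 / 6 : ℝ) := Real.rpow_pos_of_pos hη _
  have hρn : ∀ n : ℕ, (η ^ (1 / 6 : ℝ)) ^ n = η ^ (n / 6 : ℝ) := fun n => by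
    rw [← Real.rpow_mul_natCast hη.le]
    congr 1
    ring
  have h6 : η = (η ^ (1 / 6 : ℝ)) ^ 6 := by rw [hρn]; norm_num
  have h4 : η ^ (2 / 3 : ℝ) = (η ^ (1 / 6 : ℝ)) ^ 4 := by rw [hρn]; norm_num
  have h2 : η ^ (1 / 3 : ℝ) = (η ^ (1 / 6 : ℝ)) ^ 2 := by rw [hρn]; norm_num
  rw [h4, h2]
  generalize η ^ (1 / 6 : ℝ) = ρ at *
  subst h6
  have hρ0 : (ρ : ℂ) ≠ 0 := by exact_mod_cast hρ.ne'
  have hvx : x ^ (1 / 4 : ℂ) = Complex.exp (Complex.log x * (1 / 4)) :=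
    Complex.cpow_def_of_ne_zero hx0 _
  have him : (Complex.log x * (1 / 4)).im = x.arg / 4 := by
    rw [mul_one_div, Complex.div_ofNat_im, Complex.log_im]
  -- Multiplication by `e` flips the sign of the sixth power, as `ε = 1` requires, and shifts `arg x
  -- / 4` from `(-π/6, 0)` to `(0, π/6)`; `e ^ 4` is the rotation that carries `γ₁` to `γ₂`.
  set e := Complex.exp ((π / 6 : ℝ) * Complex.I) with he
  have he3 : e ^ 3 = Complex.I := by
    refine Eq.trans ?_ Complex.exp_pi_div_two_mul_I
    rw [he, ← Complex.exp_nat_mul]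
    congr 1
    push_cast
    ring
  have he4 : e ^ 4 = Complex.exp ((2 * π / 3 : ℝ) * Complex.I) := by
    rw [he, ← Complex.exp_nat_mul]
    congr 1
    push_cast
    ring
  have hA1 : AiryWKB.Admissible (x ^ (1 / 4 : ℂ)) := by
    rw [hvx]
    refine AiryWKB.admissible_exp ?_ ?_ <;> rw [him]
    · rw [abs_lt]
      constructor <;> linarith
    · exact (by linarith : x.arg / 4 < 0).ne
  have hA2 : AiryWKB.Admissible (x ^ (1 / 4 : ℂ) * e) := by
    have him' : (Complex.log x * (1 / 4) + (π / 6 : ℝ) * Complex.I).im = x.arg / 4 + π / 6 := by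
      rw [Complex.add_im, him, Complex.im_ofReal_mul, Complex.I_im, mul_one]
    rw [hvx, he, ← Complex.exp_add]
    refine AiryWKB.admissible_exp ?_ ?_ <;> rw [him']
    · rw [abs_lt]
      constructor <;> linarith
    · exact (by linarith : 0 < x.arg / 4 + π / 6).ne'
  have he6 : e ^ 6 = -1 := by
    rw [show e ^ 6 = (e ^ 3) ^ 2 by ring, he3, Complex.I_sq]
  obtain ⟨hS1, hB1⟩ := AiryWKB.borelSum_wkb (ε := -1) (by norm_num) hx0 hA1 (by ring) hρ
  obtain ⟨hS2, hB2⟩ := AiryWKB.borelSum_wkb (ε := 1) (v' := x ^ (1 / 4 : ℂ) * e) (by norm_num) hx0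
    hA2 (by rw [mul_pow, he6]; ring) hρ
  have hv0 := hA1.1
  have hI := Complex.I_ne_zero
  have hπ : ((√π : ℝ) : ℂ) ^ 2 = π := by
    rw [← Complex.ofReal_pow, Real.sq_sqrt Real.pi_pos.le]
  have hπ0 : ((√π : ℝ) : ℂ) ≠ 0 := by exact_mod_cast (Real.sqrt_pos.2 Real.pi_pos).ne'
  rw [AiryWKB.cpow_quarter_pow_four, div_self hv0] at hB1
  rw [mul_pow, AiryWKB.cpow_quarter_pow_four, mul_div_cancel_left₀ _ hv0] at hB2
  have hA : AiryWKB.Ai (((ρ ^ 4 : ℝ) : ℂ) * x) =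
      ((ρ ^ 2 : ℝ) : ℂ) * (1 / (2 * (√π : ℂ))) * AiryWKB.PsiMinus x (ρ ^ 6) := by
    rw [AiryWKB.PsiMinus, hB1, AiryWKB.Ai, ← hπ]
    push_cast
    field_simp
  refine ⟨hS2, hS1, hA, ?_⟩
  have hB : AiryWKB.airyContour₂ (((ρ ^ 4 : ℝ) : ℂ) * x) =
      -(ρ ^ 2 * (√π : ℂ) * AiryWKB.PsiPlus x (ρ ^ 6)) := by
    rw [AiryWKB.airyContour₂_eq he4, AiryWKB.PsiPlus, hB2]
    have : e ^ 4 * (((ρ ^ 4 : ℝ) : ℂ) * x) = ρ ^ 4 * (x * e ^ 4) := by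
      push_cast
      ring
    rw [this]
    field_simp
    linear_combination e * AiryWKB.airyContour₁ (e ^ 4 * ρ ^ 4 * x) * (Complex.I * he3 + Complex.I_sq)
  -- Eliminating `γ₃` turns `-γ₂ + γ₃` into `-γ₁ - 2 γ₂`; the `γ₁` part is the `Ψ₋` term of `Bi`.
  rw [AiryWKB.Bi, AiryWKB.airyContour₃_eq, hB]
  rw [AiryWKB.Ai] at hA
  have hC : AiryWKB.airyContour₁ (((ρ ^ 4 : ℝ) : ℂ) * x) =
      ρ ^ 2 * (√π : ℂ) * Complex.I * AiryWKB.PsiMinus x (ρ ^ 6) := by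
    rw [← hπ] at hA
    push_cast at hA ⊢
    field_simp at hA
    linear_combination hA
  rw [hC, ← hπ]
  push_cast
  field_simp
  ring
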